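/- Let $a<t<b$, $T=b-a$, let $m\ge 1$ be an integer, and let $f(x)=\dfrac{g(x)}{(x-t)^m}$ for $x\in[a,b]\setminus\{t\}$, where $g\in C^\infty[a,b]$ is complex-valued; assume that $f$ is $T$-periodic and infinitely differentiable on $\mathbb{R}_t=\mathbb{R}\setminus\{t+kT: k\in\mathbb{Z}\}$. The Hadamard finite part $I[f]$ of $\int_a^b f(x)\,dx$ is the sum of the finite parts, as $\epsilon\to0+$, of $\int_a^{t-\epsilon}f(x)\,dx$ and $\int_{t+\epsilon}^b f(x)\,dx$; here $F(\epsilon)$ has finite part $L$ if $F(\epsilon)-\sum_{k=1}^N c_k\epsilon^{-k}-d\log\epsilon\to L$ as $\epsilon\to0+$ for some $N$ and some constants $c_1,\dots,c_N,d$. For $n\ge1$ let $h=T/n$, $A_n=h\sum_{j=1}^{n-1}f(t+jh)$, $M_n=h\sum_{j=1}^{n}f(t+jh-h/2)$. Let $r=\lfloor m/2\rfloor$ and $p=m-2r$, and with the Riemann zeta function $\zeta$ put $$\widehat T^{(0)}_{m,n}[f]=A_n-2\sum_{i=0}^{r}\frac{g^{(2i+p)}(t)}{(2i+p)!}\,\zeta(2r-2i)\,h^{-2r+2i+1}.$$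 For $s\ge0$ define the Richardson-like extrapolations (eliminating successively $h^1,h^{-1},h^{-3},\dots$) by $$\widehat T^{(s+1)}_{m,n}[f]=\frac{2^{1-2s}\,\widehat T^{(s)}_{m,2n}[f]-\widehat T^{(s)}_{m,n}[f]}{2^{1-2s}-1}.$$ Call a sequence $Q_n$ spectrally accurate if $\lim_{n\to\infty}Q_n=I[f]$ and $Q_n-I[f]=o(n^{-\mu})$ as $n\to\infty$ for every $\mu>0$. **Theorem 4.1.** The finite part $I[f]$ exists and is unique, and the following are spectrally accurate: 1. $Q_n=\widehat T^{(s)}_{m,n}[f]$, for every $s=0,1,2,\dots$; 2. $Q_n=\sum_{k=0}^{s}\alpha_k\,\widehat T^{(0)}_{m,2^kn}[f]$, for every $s\ge0$ and all constants $\alpha_0,\dots,\alpha_s\in\mathbb{C}$ independent of $n$ with $\sum_{k=0}^s\alpha_k=1$; 3. the explicit rules - $m=1$: $A_n+g'(t)h$ and $M_n$; - $m=2$: $A_n-\frac{\pi^2}{3}g(t)h^{-1}+\frac12 g''(t)h$, $\;M_n-\pi^2g(t)h^{-1}$, and $2M_n-M_{2n}$; - $m=3$: $A_n-\frac{\pi^2}{3}g'(t)h^{-1}+\frac16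 g'''(t)h$, $\;M_n-\pi^2g'(t)h^{-1}$, and $2M_n-M_{2n}$; - $m=4$: $A_n-\frac{\pi^4}{45}g(t)h^{-3}-\frac{\pi^2}{6}g''(t)h^{-1}+\frac1{24}g^{(4)}(t)h$, $\;M_n-\frac{\pi^4}{3}g(t)h^{-3}-\frac{\pi^2}{2}g''(t)h^{-1}$, $\;2M_n-M_{2n}+2\pi^4g(t)h^{-3}$, and $\frac{16}{7}M_n-\frac{10}{7}M_{2n}+\frac17M_{4n}$. -/

import Mathlib

open Filter Topology MeasureTheory Asymptotics
open scoped ContDiff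

/-- `F ε` (as `ε → 0+`) has finite part `L`: after removal of a linear combination of the divergent
terms `ε⁻¹, …, ε⁻ᴺ` and `log ε`, it tends to `L`. -/
def HasFinitePartAtZero (F : ℝ → ℂ) (L : ℂ) : Prop :=
  ∃ (N : ℕ) (c : ℕ → ℂ) (d : ℂ),
    Tendsto (fun ε : ℝ =>
        F ε - ∑ k ∈ Finset.Icc 1 N, c k / (ε : ℂ) ^ k - d * (Real.log ε : ℂ))
      (𝓝[>] (0 : ℝ)) (𝓝 L)

/-- `I` is the Hadamard finite part of `∫_a^b f(x) dx`, where `f` is singular only at the interior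
point `t`: it is the finite part of `∫_a^{t-ε} f` plus the finite part of `∫_{t+ε}^b f`. -/
def HasHadamardFinitePart (f : ℝ → ℂ) (a t b : ℝ) (I : ℂ) : Prop :=
  (∀ᶠ ε : ℝ in 𝓝[>] (0 : ℝ),
    IntervalIntegrable f volume a (t - ε) ∧ IntervalIntegrable f volume (t + ε) b) ∧
  ∃ L R : ℂ,
    HasFinitePartAtZero (fun ε => ∫ x in a..(t - ε), f x) L ∧
    HasFinitePartAtZero (fun ε => ∫ x in (t + ε)..b, f x) R ∧
    I = L + R

/-- The real line without the points `t + k T`, `k ∈ ℤ`. -/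
def puncturedLine (t T : ℝ) : Set ℝ := {x | ∀ k : ℤ, x ≠ t + k * T}

/-- The step `h = T / n`. -/
noncomputable def mesh (T : ℝ) (n : ℕ) : ℝ := T / n

/-- The punctured trapezoidal sum `h ∑_{j=1}^{n-1} f(t + j h)`, `h = T / n`. -/
noncomputable def trapezoidal (f : ℝ → ℂ) (t T : ℝ) (n : ℕ) : ℂ :=
  (mesh T n : ℂ) * ∑ j ∈ Finset.Ico 1 n, f (t + j * mesh T n)

/-- The midpoint sum `h ∑_{j=1}^{n} f(t + j h - h / 2)`, `h = T / n`. -/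
noncomputable def midpointSum (f : ℝ → ℂ) (t T : ℝ) (n : ℕ) : ℂ :=
  (mesh T n : ℂ) * ∑ j ∈ Finset.Icc 1 n, f (t + j * mesh T n - mesh T n / 2)

/-- The corrected trapezoidal rule for `f(x) = g(x) / (x - t)^m`. With `r = ⌊m / 2⌋` the correction
is `- 2 ∑_{i=0}^r g^{(e)}(t) / e! · ζ(2r - 2i) h^{-2r+2i+1}`, where `e = 2i` if `m = 2r` is even and
`e = 2i + 1` if `m = 2r + 1` is odd. -/
noncomputable def correctedTrapezoidal (f g : ℝ → ℂ) (t T : ℝ) (m n : ℕ) : ℂ :=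
  trapezoidal f t T n -
    2 * ∑ i ∈ Finset.range (m / 2 + 1),
      iteratedDeriv (2 * i + m % 2) g t / (Nat.factorial (2 * i + m % 2) : ℂ) *
        riemannZeta (2 * ((m / 2 : ℕ) : ℂ) - 2 * (i : ℂ)) *
        (mesh T n : ℂ) ^ (2 * (i : ℤ) + 1 - 2 * ((m / 2 : ℕ) : ℤ))

/-- The rule obtained from the corrected trapezoidal rule by `s` Richardson-like steps. Step `s + 1`
combines the values at `n` and `2 n` so as to eliminate the power `h ^ (1 - 2 s)`; thus the powers
`h, h⁻¹, h⁻³, …` are eliminated in this order. -/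
noncomputable def richardsonRule (f g : ℝ → ℂ) (t T : ℝ) (m : ℕ) : ℕ → ℕ → ℂ
  | 0, n => correctedTrapezoidal f g t T m n
  | s + 1, n =>
      ((2 : ℂ) ^ (1 - 2 * (s : ℤ)) * richardsonRule f g t T m s (2 * n)
          - richardsonRule f g t T m s n) /
        ((2 : ℂ) ^ (1 - 2 * (s : ℤ)) - 1)

/-- `Q n → I`, and the error is `o(n^{-μ})` for every `μ > 0`. -/
def SpectrallyAccurate (Q : ℕ → ℂ) (I : ℂ) : Prop :=
  Tendsto Q atTop (𝓝 I) ∧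
  ∀ μ : ℝ, 0 < μ → (fun n : ℕ => Q n - I) =o[atTop] (fun n : ℕ => (n : ℝ) ^ (-μ))

/-!
Put `F u = f (t + u)`. Neither the punctured sums nor the finite part change when `F` is replaced by
its even part, whose pole at `0` has only even orders `k` with `2 ≤ k ≤ m`; the coefficients are
Taylor coefficients of `g` at `t` (`exists_contDiff_taylor_quotient_on_Icc`,
`even_part_polar_expansion`).

Such a pole is carried by the `T`-periodic lattice sum `φ (u / T)`, where
`φ z = ∑_{l ∈ ℤ} (z + l)⁻ᵏ` is `latticeSum k`. Two facts about it are exact. Grouping the integers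
by residues modulo `n` gives `∑_{j < n} φ (j / n) = 2 ζ(k) nᵏ`, where the term at `j = 0` is read
without its pole (`sum_latticeSum_div`). And the finite part of its integral over a period is zero
(`hasFinitePartAtZero_integral_latticeSum`). Subtracting the right multiples of lattice sums leaves
a smooth `T`-periodic function `G`. The corrections by zeta values in the corrected trapezoidal rule
are precisely the contributions of the lattice sums and of the omitted node `j = 0`, so that for
every `n ≥ 1` this rule equals the ordinary trapezoidal rule for `G`, while the Hadamard finite part
is `∫₀ᵀ G` (`exists_periodic_regularization`).

For smooth periodic functions the trapezoidal rule converges faster than any power of the step,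
since all boundary terms of the Euler–Maclaurin formula cancel
(`exists_norm_trapezoid_sub_integral_le`). All other rules are combinations, with coefficients of
sum one, of the corrected trapezoidal rule at multiples of `n`; the midpoint rules are so because
the midpoint sum is `2 A₂ₙ - Aₙ` (`midpointSum_eq`).
-/

/-! ### Division by powers and Taylor expansion -/

theorem iteratedDeriv_eq_of_hasDerivAt_chain {Q : ℕ → ℝ → ℂ}
    (hQ : ∀ j u, HasDerivAt (Q j) (Q (j + 1) u) u) (j : ℕ) : iteratedDeriv j (Q 0) = Q j := by
  induction j with
  | zero => simp
  | succ j ih =>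
    rw [iteratedDeriv_succ, ih]
    exact funext fun u => (hQ j u).deriv

theorem contDiff_of_hasDerivAt_chain {Q : ℕ → ℝ → ℂ}
    (hQ : ∀ j u, HasDerivAt (Q j) (Q (j + 1) u) u) : ContDiff ℝ ∞ (Q 0) := by
  refine contDiff_of_differentiable_iteratedDeriv fun j _ => ?_
  rw [iteratedDeriv_eq_of_hasDerivAt_chain hQ]
  exact fun u => (hQ j u).differentiableAt

theorem contDiff_infty_iteratedDeriv {h : ℝ → ℂ} (hh : ContDiff ℝ ∞ h) (j : ℕ) :
    ContDiff ℝ ∞ (iteratedDeriv j h) := by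
  induction j with
  | zero => simpa
  | succ j ih => rw [iteratedDeriv_succ]; exact (contDiff_infty_iff_deriv.1 ih).2

theorem hasDerivAt_iteratedDeriv {h : ℝ → ℂ} (hh : ContDiff ℝ ∞ h) (j : ℕ) (u : ℝ) :
    HasDerivAt (iteratedDeriv j h) (iteratedDeriv (j + 1) h u) u := by
  rw [iteratedDeriv_succ]
  exact ((contDiff_infty_iff_deriv.1 (contDiff_infty_iteratedDeriv hh j)).1 u).hasDerivAt

/-- The integral occurring as the `j`-th derivative of the quotient `(h u - h 0) / u`. -/
noncomputable def quotientDeriv (h : ℝ → ℂ) (j : ℕ) (u : ℝ) : ℂ :=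
  ∫ s in (0 : ℝ)..1, (s : ℂ) ^ j * iteratedDeriv (j + 1) h (s * u)

theorem hasDerivAt_quotientDeriv {h : ℝ → ℂ} (hh : ContDiff ℝ ∞ h) (j : ℕ) (u : ℝ) :
    HasDerivAt (quotientDeriv h j) (quotientDeriv h (j + 1) u) u := by
  have hc := fun i => (contDiff_infty_iteratedDeriv hh i).continuous
  have hcont : ∀ i l : ℕ, Continuous fun p : ℝ × ℝ =>
      (p.1 : ℂ) ^ i * iteratedDeriv l h (p.1 * p.2) := fun i l => by
    have := hc l; fun_prop
  have hcont' : ∀ (i l : ℕ) (x : ℝ), Continuous fun s : ℝ =>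
      (s : ℂ) ^ i * iteratedDeriv l h (s * x) := fun i l x => by
    have := hc l; fun_prop
  obtain ⟨C, hC⟩ := ((isCompact_Icc (a := (0 : ℝ)) (b := 1)).prod
    (isCompact_closedBall u 1)).exists_bound_of_continuousOn (hcont (j + 1) (j + 2)).continuousOn
  refine (intervalIntegral.hasDerivAt_integral_of_dominated_loc_of_deriv_le
    (μ := volume) (s := Metric.ball u 1) (bound := fun _ => C)
    (F := fun x s => (s : ℂ) ^ j * iteratedDeriv (j + 1) h (s * x))
    (F' := fun x s => (s : ℂ) ^ (j + 1) * iteratedDeriv (j + 2) h (s * x))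
    (Metric.ball_mem_nhds u one_pos) ?_ ?_ ?_ ?_ ?_ ?_).2
  · exact Eventually.of_forall fun x => (hcont' _ _ x).aestronglyMeasurable
  · exact (hcont' _ _ u).intervalIntegrable _ _
  · exact (hcont' _ _ u).aestronglyMeasurable
  · refine Eventually.of_forall fun s hs x hx => hC (s, x) ⟨?_, Metric.ball_subset_closedBall hx⟩
    rw [Set.uIoc_of_le zero_le_one] at hs
    exact ⟨hs.1.le, hs.2⟩
  · exact intervalIntegrable_const
  · refine Eventually.of_forall fun s _ x _ => ?_
    have h1 := (hasDerivAt_iteratedDeriv hh (j + 1) (s * x)).scomp x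
      ((hasDerivAt_id x).const_mul s)
    have h2 := h1.const_mul ((s : ℂ) ^ j)
    refine h2.congr_deriv ?_
    simp only [mul_one, Complex.real_smul]
    ring

/-- Hadamard's lemma: `(h u - h 0) / u = ∫₀¹ h'(s u) ds`. -/
theorem eq_add_mul_quotientDeriv {h : ℝ → ℂ} (hh : ContDiff ℝ ∞ h) (u : ℝ) :
    h u = h 0 + u * quotientDeriv h 0 u := by
  have hc := (contDiff_infty_iteratedDeriv hh 1).continuous
  have h1 : ∀ s : ℝ,
      HasDerivAt (fun s : ℝ => h (s * u)) ((u : ℂ) * iteratedDeriv 1 h (s * u)) s := by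
    intro s
    have h2 := hasDerivAt_iteratedDeriv hh 0 (s * u)
    rw [iteratedDeriv_zero] at h2
    refine (h2.scomp s ((hasDerivAt_id s).mul_const u)).congr_deriv ?_
    simp
  have h3 := intervalIntegral.integral_eq_sub_of_hasDerivAt (a := 0) (b := 1) (fun s _ => h1 s)
    (Continuous.intervalIntegrable (by fun_prop) _ _)
  rw [intervalIntegral.integral_const_mul] at h3
  simp only [one_mul, zero_mul] at h3
  simp only [quotientDeriv, pow_zero, one_mul, zero_add]
  rw [h3]; ring

theorem quotientDeriv_zero (h : ℝ → ℂ) (j : ℕ) :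
    quotientDeriv h j 0 = iteratedDeriv (j + 1) h 0 / (j + 1) := by
  have : ∫ s in (0 : ℝ)..1, (s : ℂ) ^ j = 1 / (j + 1) := by
    have := integral_pow (a := 0) (b := 1) j
    have h2 : ∫ s in (0 : ℝ)..1, (s : ℂ) ^ j = ((∫ s in (0 : ℝ)..1, s ^ j : ℝ) : ℂ) := by
      rw [← intervalIntegral.integral_ofReal]; simp
    rw [h2, this]; simp
  simp only [quotientDeriv, mul_zero]
  rw [intervalIntegral.integral_mul_const, this]; ring

/-- Taylor expansion with smooth quotient: the remainder of order `m` is `u ^ m` times a smooth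
function, whose value at `0` is the next Taylor coefficient. -/
theorem exists_contDiff_taylor_quotient (m : ℕ) : ∀ {h : ℝ → ℂ}, ContDiff ℝ ∞ h →
    ∃ q : ℝ → ℂ, ContDiff ℝ ∞ q ∧ q 0 = iteratedDeriv m h 0 / (m.factorial : ℂ) ∧
      ∀ u : ℝ, h u = ∑ j ∈ Finset.range m, iteratedDeriv j h 0 / (j.factorial : ℂ) * (u : ℂ) ^ j
        + (u : ℂ) ^ m * q u := by
  induction m with
  | zero => exact fun {h} hh => ⟨h, hh, by simp, by simp⟩
  | succ m ih =>
    intro h hh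
    have hQ := hasDerivAt_quotientDeriv hh
    have hco : ∀ j : ℕ, iteratedDeriv j (quotientDeriv h 0) 0 / (j.factorial : ℂ)
        = iteratedDeriv (j + 1) h 0 / ((j + 1).factorial : ℂ) := by
      intro j
      rw [iteratedDeriv_eq_of_hasDerivAt_chain hQ, quotientDeriv_zero, div_div,
        Nat.factorial_succ]
      push_cast; rfl
    obtain ⟨q, hq, hq0, hqe⟩ := ih (contDiff_of_hasDerivAt_chain hQ)
    refine ⟨q, hq, hq0.trans (hco m), fun u => ?_⟩
    rw [eq_add_mul_quotientDeriv hh u, hqe u, Finset.sum_range_succ']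
    simp only [hco]
    rw [mul_add, Finset.mul_sum]
    simp only [iteratedDeriv_zero, Nat.factorial_zero, Nat.cast_one, div_one, pow_zero, mul_one]
    rw [Finset.sum_congr rfl fun j _ => show (u : ℂ) * (iteratedDeriv (j + 1) h 0 /
      ((j + 1).factorial : ℂ) * (u : ℂ) ^ j) = iteratedDeriv (j + 1) h 0 /
      ((j + 1).factorial : ℂ) * (u : ℂ) ^ (j + 1) by ring]
    ring

/-! ### The trapezoidal rule for smooth periodic functions -/

theorem periodic_iteratedDeriv {G : ℝ → ℂ} {T : ℝ} (hG : Function.Periodic G T) (K : ℕ) :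
    Function.Periodic (iteratedDeriv K G) T := by
  intro x
  have h := iteratedDeriv_comp_add_const K G T
  rw [show (fun z => G (z + T)) = G from funext hG] at h
  exact (congrFun h x).symm

/-- Euler–Maclaurin formula for a smooth `1`-periodic function: all boundary terms cancel. -/
theorem integral_bernoulliFun_mul_iteratedDeriv {P : ℝ → ℂ} (hP : ContDiff ℝ ∞ P)
    (hper : Function.Periodic P 1) (K : ℕ) :
    ∫ x in (0 : ℝ)..1, (bernoulliFun (K + 1) x : ℂ) * iteratedDeriv (K + 1) P x =
      (-1) ^ K * ((K + 1).factorial : ℂ) * (P 0 - ∫ x in (0 : ℝ)..1, P x) := by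
  have hc := fun i => (contDiff_infty_iteratedDeriv hP i).continuous
  have hB : ∀ k x, HasDerivAt (fun x : ℝ => (bernoulliFun (k + 1) x : ℂ))
      (((k + 1) * bernoulliFun k x : ℝ) : ℂ) x := fun k x => by
    simpa using (hasDerivAt_bernoulliFun (k + 1) x).ofReal_comp
  have hBc : ∀ k, Continuous fun x : ℝ => (bernoulliFun k x : ℂ) := fun k => by
    have := continuous_bernoulliFun k
    fun_prop
  have parts := fun k => intervalIntegral.integral_mul_deriv_eq_deriv_mul (a := 0) (b := 1)
    (u := fun x : ℝ => (bernoulliFun (k + 1) x : ℂ)) (v := iteratedDeriv k P)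
    (u' := fun x => (((k + 1) * bernoulliFun k x : ℝ) : ℂ)) (v' := iteratedDeriv (k + 1) P)
    (fun x _ => hB k x) (fun x _ => hasDerivAt_iteratedDeriv hP k x)
    (Continuous.intervalIntegrable (by have := hBc k; push_cast; fun_prop) _ _)
    ((hc (k + 1)).intervalIntegrable _ _)
  have hend : ∀ k, iteratedDeriv k P 1 = iteratedDeriv k P 0 := fun k => by
    simpa using periodic_iteratedDeriv hper k 0
  induction K with
  | zero =>
    rw [parts 0, hend, bernoulliFun_eval_one]
    simp [bernoulliFun_eval_zero]
    ring
  | succ K ih =>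
    rw [parts (K + 1), hend, bernoulliFun_eval_one, if_neg (by omega)]
    simp only [Complex.ofReal_mul, mul_assoc]
    rw [intervalIntegral.integral_const_mul, ih, Nat.factorial_succ (K + 1)]
    push_cast
    ring

/-- On smooth periodic functions the trapezoidal rule converges faster than any power of the
step. -/
theorem exists_norm_trapezoid_sub_integral_le {G : ℝ → ℂ} {T : ℝ} (hT : 0 < T)
    (hG : ContDiff ℝ ∞ G) (hper : Function.Periodic G T) (K : ℕ) :
    ∃ C : ℝ, ∀ n : ℕ, 1 ≤ n →
      ‖(mesh T n : ℂ) * ∑ j ∈ Finset.range n, G (j * mesh T n) - ∫ x in (0 : ℝ)..T, G x‖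
        ≤ C * mesh T n ^ (K + 1) := by
  have hGd := fun i => hasDerivAt_iteratedDeriv hG i
  obtain ⟨M, hM⟩ := (isCompact_Icc (a := (0 : ℝ)) (b := T)).exists_bound_of_continuousOn
    (contDiff_infty_iteratedDeriv hG (K + 1)).continuous.continuousOn
  obtain ⟨D, hD⟩ := (isCompact_Icc (a := (0 : ℝ)) (b := 1)).exists_bound_of_continuousOn
    (continuous_bernoulliFun (K + 1)).continuousOn
  have hM0 : 0 ≤ M := (norm_nonneg _).trans (hM 0 ⟨le_rfl, hT.le⟩)
  have hD0 : 0 ≤ D := (norm_nonneg _).trans (hD 0 ⟨le_rfl, zero_le_one⟩)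
  refine ⟨T * (D * M), fun n hn => ?_⟩
  have hn0 : (0 : ℝ) < n := by exact_mod_cast hn
  set h := mesh T n with hh
  have hpos : 0 < h := div_pos hT hn0
  have hnh : n * h = T := by rw [hh, mesh]; field_simp
  -- averaging over the `n` cells turns `G` into a `1`-periodic function of the cell coordinate
  set Q : ℕ → ℝ → ℂ := fun k x =>
    (h : ℂ) ^ k * ∑ j ∈ Finset.range n, iteratedDeriv k G ((j + x) * h) with hQdef
  have hQ : ∀ k x, HasDerivAt (Q k) (Q (k + 1) x) x := by
    intro k x
    have h1 : ∀ j ∈ Finset.range n, HasDerivAt (fun x : ℝ => iteratedDeriv k G ((j + x) * h))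
        ((h : ℂ) * iteratedDeriv (k + 1) G ((j + x) * h)) x := by
      intro j _
      refine ((hGd k ((j + x) * h)).scomp x
        (((hasDerivAt_id x).const_add (j : ℝ)).mul_const h)).congr_deriv ?_
      simp
    refine ((HasDerivAt.fun_sum h1).const_mul ((h : ℂ) ^ k)).congr_deriv ?_
    rw [← Finset.mul_sum]
    simp only [hQdef]; ring
  have hQs : ContDiff ℝ ∞ (Q 0) := contDiff_of_hasDerivAt_chain hQ
  have hQper : Function.Periodic (Q 0) 1 := by
    intro x
    simp only [hQdef, pow_zero, one_mul, iteratedDeriv_zero]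
    have h1 := Finset.sum_range_succ' (fun j : ℕ => G ((j + x) * h)) n
    rw [Finset.sum_range_succ] at h1
    have h2 : G ((n + x) * h) = G (((0 : ℕ) + x) * h) := by
      rw [add_mul, hnh, add_comm, hper]; simp
    rw [h2] at h1
    rw [add_right_cancel h1]
    refine Finset.sum_congr rfl fun j _ => ?_
    push_cast; congr 1; ring
  have hint : ∫ x in (0 : ℝ)..1, Q 0 x = (h : ℂ)⁻¹ * ∫ x in (0 : ℝ)..T, G x := by
    simp only [hQdef, pow_zero, one_mul, iteratedDeriv_zero]
    have hGc := hG.continuous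
    rw [intervalIntegral.integral_finsetSum fun j _ =>
      Continuous.intervalIntegrable (by fun_prop) _ _]
    have hcell : ∀ j : ℕ, ∫ x in (0 : ℝ)..1, G ((j + x) * h)
        = (h : ℂ)⁻¹ * ∫ x in (j * h)..((j + 1 : ℕ) * h), G x := by
      intro j
      have h1 := intervalIntegral.integral_comp_mul_add (a := 0) (b := 1) G hpos.ne' (j * h)
      simp only [Complex.real_smul] at h1
      rw [show (fun x : ℝ => G ((j + x) * h)) = fun x => G (h * x + j * h) from
        funext fun x => by ring_nf, h1]
      push_cast
      ring_nf
    simp only [hcell]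
    rw [← Finset.mul_sum, intervalIntegral.sum_integral_adjacent_intervals (a := fun j : ℕ => j * h)
      fun k _ => hGc.intervalIntegrable _ _]
    simp [hnh]
  have hEM := integral_bernoulliFun_mul_iteratedDeriv hQs hQper K
  rw [iteratedDeriv_eq_of_hasDerivAt_chain hQ] at hEM
  have hbound : ‖∫ x in (0 : ℝ)..1, (bernoulliFun (K + 1) x : ℂ) * Q (K + 1) x‖
      ≤ (D * (h ^ (K + 1) * (n * M))) * |1 - 0| := by
    refine intervalIntegral.norm_integral_le_of_norm_le_const fun x hx => ?_
    rw [Set.uIoc_of_le zero_le_one] at hx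
    have hx' : x ∈ Set.Icc (0 : ℝ) 1 := ⟨hx.1.le, hx.2⟩
    rw [norm_mul, Complex.norm_real]
    refine mul_le_mul (hD x hx') ?_ (norm_nonneg _) hD0
    simp only [hQdef, norm_mul, norm_pow, Complex.norm_real, Real.norm_of_nonneg hpos.le]
    refine mul_le_mul_of_nonneg_left ?_ (by positivity)
    rw [show (n : ℝ) * M = ∑ _j ∈ Finset.range n, M by simp]
    refine norm_sum_le_of_le _ fun j hj => hM _ ?_
    have hjn : (j : ℝ) + 1 ≤ n := by exact_mod_cast Finset.mem_range.1 hj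
    refine ⟨mul_nonneg (add_nonneg j.cast_nonneg hx'.1) hpos.le, ?_⟩
    rw [← hnh]
    exact mul_le_mul_of_nonneg_right (by linarith [hx'.2]) hpos.le
  rw [hEM, norm_mul, norm_mul, norm_pow, norm_neg, norm_one, one_pow, one_mul,
    Complex.norm_natCast, hint] at hbound
  have hfac : (1 : ℝ) ≤ (K + 1).factorial := by
    exact_mod_cast Nat.one_le_iff_ne_zero.2 (Nat.factorial_ne_zero _)
  have hE : (h : ℂ) * ∑ j ∈ Finset.range n, G (j * h) - ∫ x in (0 : ℝ)..T, G x
      = (h : ℂ) * (Q 0 0 - (h : ℂ)⁻¹ * ∫ x in (0 : ℝ)..T, G x) := by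
    have : (h : ℂ) ≠ 0 := by exact_mod_cast hpos.ne'
    rw [mul_sub, mul_inv_cancel_left₀ this]
    simp [hQdef]
  rw [hE, norm_mul, Complex.norm_real, Real.norm_of_nonneg hpos.le]
  have h1 := (le_mul_of_one_le_left (norm_nonneg _) hfac).trans hbound
  calc h * _ ≤ h * (D * (h ^ (K + 1) * (n * M)) * |1 - 0|) :=
        mul_le_mul_of_nonneg_left h1 hpos.le
    _ = (n * h) * (D * M) * h ^ (K + 1) := by simp; ring
    _ = _ := by rw [hnh]

/-! ### Finite parts -/

theorem hasFinitePartAtZero_of_tendsto {F : ℝ → ℂ} {L : ℂ} (h : Tendsto F (𝓝[>] 0) (𝓝 L)) :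
    HasFinitePartAtZero F L :=
  ⟨0, 0, 0, by simpa using h⟩

theorem HasFinitePartAtZero.congr' {F G : ℝ → ℂ} {L : ℂ} (h : HasFinitePartAtZero F L)
    (hFG : ∀ᶠ ε in 𝓝[>] (0 : ℝ), F ε = G ε) : HasFinitePartAtZero G L := by
  obtain ⟨N, c, d, h⟩ := h
  exact ⟨N, c, d, h.congr' (hFG.mono fun ε hε => by rw [hε])⟩

theorem HasFinitePartAtZero.const_mul {F : ℝ → ℂ} {L : ℂ} (h : HasFinitePartAtZero F L) (z : ℂ) :
    HasFinitePartAtZero (fun ε => z * F ε) (z * L) := by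
  obtain ⟨N, c, d, h⟩ := h
  refine ⟨N, fun k => z * c k, z * d, (h.const_mul z).congr fun ε => ?_⟩
  simp only [mul_sub, Finset.mul_sum, mul_div_assoc, mul_assoc]

theorem sum_Icc_ite_div_pow {N M : ℕ} (h : N ≤ M) (c : ℕ → ℂ) (z : ℂ) :
    ∑ k ∈ Finset.Icc 1 M, (if k ≤ N then c k else 0) / z ^ k
      = ∑ k ∈ Finset.Icc 1 N, c k / z ^ k := by
  rw [← Finset.sum_subset (Finset.Icc_subset_Icc_right h)]
  · exact Finset.sum_congr rfl fun k hk => by rw [if_pos (Finset.mem_Icc.1 hk).2]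
  · intro k hk hk'
    simp only [Finset.mem_Icc, not_and] at hk hk'
    rw [if_neg (hk' hk.1), zero_div]

theorem HasFinitePartAtZero.add {F G : ℝ → ℂ} {L M : ℂ} (hF : HasFinitePartAtZero F L)
    (hG : HasFinitePartAtZero G M) : HasFinitePartAtZero (fun ε => F ε + G ε) (L + M) := by
  obtain ⟨N₁, c₁, d₁, hF⟩ := hF
  obtain ⟨N₂, c₂, d₂, hG⟩ := hG
  refine ⟨max N₁ N₂, fun k => (if k ≤ N₁ then c₁ k else 0) + (if k ≤ N₂ then c₂ k else 0),
    d₁ + d₂, (hF.add hG).congr fun ε => ?_⟩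
  simp only [add_div, Finset.sum_add_distrib]
  rw [sum_Icc_ite_div_pow (le_max_left _ _), sum_Icc_ite_div_pow (le_max_right _ _)]
  ring

theorem HasFinitePartAtZero.sum {ι : Type*} (s : Finset ι) {F : ι → ℝ → ℂ} {L : ι → ℂ}
    (h : ∀ i ∈ s, HasFinitePartAtZero (F i) (L i)) :
    HasFinitePartAtZero (fun ε => ∑ i ∈ s, F i ε) (∑ i ∈ s, L i) := by
  classical
  induction s using Finset.induction_on with
  | empty => exact hasFinitePartAtZero_of_tendsto (by simp)
  | insert i s hi ih =>
    simp only [Finset.sum_insert hi]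
    exact (h i (Finset.mem_insert_self _ _)).add
      (ih fun j hj => h j (Finset.mem_insert_of_mem hj))

/-- Negative powers, the logarithm and the constant function are asymptotically independent
at `0+`. -/
theorem eq_zero_of_tendsto_sum_div_pow_add_log (N : ℕ) : ∀ {c : ℕ → ℂ} {d L : ℂ},
    Tendsto (fun ε : ℝ => ∑ k ∈ Finset.Icc 1 N, c k / (ε : ℂ) ^ k + d * (Real.log ε : ℂ))
      (𝓝[>] (0 : ℝ)) (𝓝 L) → L = 0 := by
  have hpow : ∀ k : ℕ, k ≠ 0 → Tendsto (fun ε : ℝ => (ε : ℂ) ^ k) (𝓝[>] (0 : ℝ)) (𝓝 0) := by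
    intro k hk
    have : Continuous fun ε : ℝ => (ε : ℂ) ^ k := by fun_prop
    simpa [hk] using (this.tendsto 0).mono_left nhdsWithin_le_nhds
  induction N with
  | zero =>
    intro c d L h
    simp only [Finset.Icc_eq_empty_of_lt zero_lt_one, Finset.sum_empty, zero_add] at h
    by_cases hd : d = 0
    · subst hd
      simpa using tendsto_nhds_unique h (by simp)
    · have h1 : Tendsto (fun ε : ℝ => ‖(Real.log ε : ℂ)‖) (𝓝[>] (0 : ℝ)) (𝓝 ‖d⁻¹ * L‖) := by
        refine (h.const_mul d⁻¹).norm.congr fun ε => ?_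
        rw [inv_mul_cancel_left₀ hd]
      have h2 : Tendsto (fun ε : ℝ => ‖(Real.log ε : ℂ)‖) (𝓝[>] (0 : ℝ)) atTop := by
        simp only [Complex.norm_real, Real.norm_eq_abs]
        exact tendsto_abs_atBot_atTop.comp Real.tendsto_log_nhdsGT_zero
      exact absurd h1 (not_tendsto_nhds_of_tendsto_atTop h2 _)
  | succ N ih =>
    intro c d L h
    -- multiplying by the highest power isolates its coefficient, which therefore vanishes
    have hlog : Tendsto (fun ε : ℝ => (ε : ℂ) ^ (N + 1) * (Real.log ε : ℂ)) (𝓝[>] (0 : ℝ))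
        (𝓝 0) := by
      have h1 := tendsto_log_mul_rpow_nhdsGT_zero (r := (N + 1 : ℕ)) (by positivity)
      have h2 := (Complex.continuous_ofReal.tendsto 0).comp h1
      rw [Complex.ofReal_zero] at h2
      refine h2.congr fun ε => ?_
      simp only [Function.comp_apply, Real.rpow_natCast]
      push_cast
      exact mul_comm _ _
    have hc : c (N + 1) = 0 := by
      have h1 := (hpow (N + 1) (by omega)).mul h
      rw [zero_mul] at h1
      have h2 : Tendsto (fun ε : ℝ => ∑ k ∈ Finset.Icc 1 N, c k * (ε : ℂ) ^ (N + 1 - k)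
          + c (N + 1) + d * ((ε : ℂ) ^ (N + 1) * (Real.log ε : ℂ)))
          (𝓝[>] (0 : ℝ)) (𝓝 (∑ k ∈ Finset.Icc 1 N, c k * 0 + c (N + 1) + d * 0)) := by
        refine (Tendsto.add_const _ (tendsto_finsetSum _ fun k hk => ?_)).add (hlog.const_mul d)
        have := (Finset.mem_Icc.1 hk).2
        exact (hpow _ (by omega)).const_mul _
      have h3 := tendsto_nhds_unique_of_eventuallyEq h1 h2 ?_
      · simpa using h3.symm
      · filter_upwards [self_mem_nhdsWithin] with ε hε
        have hε0 : (ε : ℂ) ≠ 0 := by exact_mod_cast (ne_of_gt hε)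
        rw [Finset.sum_Icc_succ_top (by omega), mul_add, mul_add,
          mul_div_cancel₀ _ (pow_ne_zero _ hε0), Finset.mul_sum, mul_left_comm]
        congr 2
        refine Finset.sum_congr rfl fun k hk => ?_
        have := (Finset.mem_Icc.1 hk).2
        rw [← Nat.sub_add_cancel (show k ≤ N + 1 by omega), pow_add, Nat.add_sub_cancel]
        field_simp
    refine ih (c := c) (d := d) (h.congr fun ε => ?_)
    rw [Finset.sum_Icc_succ_top (by omega), hc, zero_div, add_zero]

theorem HasFinitePartAtZero.unique {F : ℝ → ℂ} {L M : ℂ} (hL : HasFinitePartAtZero F L)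
    (hM : HasFinitePartAtZero F M) : L = M := by
  obtain ⟨N, c, d, h⟩ := hL.add (hM.const_mul (-1))
  have h1 : L + -1 * M = 0 := by
    refine eq_zero_of_tendsto_sum_div_pow_add_log N (c := fun k => -c k) (d := -d)
      (h.congr fun ε => ?_)
    simp only [neg_div, Finset.sum_neg_distrib]
    ring
  linear_combination h1

theorem integral_inv_pow {a b : ℝ} (ha : 0 < a) (hb : 0 < b) {k : ℕ} (hk : 2 ≤ k) :
    ∫ x in a..b, ((x : ℂ) ^ k)⁻¹
      = (((a : ℂ) ^ (k - 1))⁻¹ - ((b : ℂ) ^ (k - 1))⁻¹) / ((k : ℂ) - 1) := by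
  have h0 : (0 : ℝ) ∉ Set.uIcc a b := fun h => by
    rcases Set.mem_uIcc.1 h with h | h <;> linarith [h.1]
  have h := integral_zpow (a := a) (b := b) (n := -(k : ℤ)) (Or.inr ⟨by omega, h0⟩)
  have h1 : ∫ x in a..b, ((x : ℂ) ^ k)⁻¹ = ((∫ x in a..b, x ^ (-(k : ℤ)) : ℝ) : ℂ) := by
    rw [← intervalIntegral.integral_ofReal]; simp
  obtain ⟨k, rfl⟩ := Nat.exists_eq_add_of_le' (show 1 ≤ k by omega)
  have e : -((k + 1 : ℕ) : ℤ) + 1 = -(k : ℤ) := by push_cast; ring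
  rw [h1, h, e]
  have hk0 : (k : ℂ) ≠ 0 := by exact_mod_cast (by omega : k ≠ 0)
  push_cast
  rw [zpow_neg, zpow_neg, zpow_natCast, zpow_natCast,
    show -((k : ℂ) + 1) + 1 = -k by ring, show (k : ℂ) + 1 - 1 = k by ring, div_neg,
    ← neg_div, neg_sub]

theorem intervalIntegrable_inv_pow {a b : ℝ} (ha : 0 < a) (hb : 0 < b) (k : ℕ) :
    IntervalIntegrable (fun x : ℝ => ((x : ℂ) ^ k)⁻¹) volume a b := by
  refine ContinuousOn.intervalIntegrable fun x hx => ContinuousAt.continuousWithinAt ?_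
  have : (x : ℂ) ≠ 0 := by
    rcases Set.mem_uIcc.1 hx with h | h <;> exact_mod_cast (by linarith [h.1] : x > 0).ne'
  exact ContinuousAt.inv₀ (by fun_prop) (pow_ne_zero _ this)

theorem hasFinitePartAtZero_integral_inv_pow {δ : ℝ} (hδ : 0 < δ) {k : ℕ} (hk : 2 ≤ k) :
    HasFinitePartAtZero (fun ε => ∫ x in ε..δ, ((x : ℂ) ^ k)⁻¹)
      (-((δ : ℂ) ^ (k - 1))⁻¹ / ((k : ℂ) - 1)) := by
  refine ⟨k - 1, fun j => if j = k - 1 then 1 / ((k : ℂ) - 1) else 0, 0, ?_⟩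
  refine tendsto_const_nhds.congr' ?_
  filter_upwards [self_mem_nhdsWithin] with ε hε
  rw [integral_inv_pow hε hδ hk]
  simp only [ite_div, zero_div, Finset.sum_ite_eq', Finset.mem_Icc]
  rw [if_pos ⟨by omega, le_rfl⟩]
  ring

theorem hasFinitePartAtZero_integral_inv {δ : ℝ} (hδ : 0 < δ) :
    HasFinitePartAtZero (fun ε => ∫ x in ε..δ, (x : ℂ)⁻¹) (Real.log δ) := by
  refine ⟨0, 0, -1, tendsto_const_nhds.congr' ?_⟩
  filter_upwards [self_mem_nhdsWithin] with ε hε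
  have h1 : ∫ x in ε..δ, (x : ℂ)⁻¹ = ((∫ x in ε..δ, x⁻¹ : ℝ) : ℂ) := by
    rw [← intervalIntegral.integral_ofReal]; simp
  rw [h1, integral_inv_of_pos hε hδ, Real.log_div hδ.ne' (ne_of_gt hε)]
  simp

theorem tendsto_integral_nhdsGT_zero {q : ℝ → ℂ} {δ : ℝ} (hδ : 0 < δ)
    (hq : ContinuousOn q (Set.Icc 0 δ)) :
    Tendsto (fun ε => ∫ x in ε..δ, q x) (𝓝[>] 0) (𝓝 (∫ x in (0 : ℝ)..δ, q x)) := by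
  have h1 : ContinuousOn (fun ε => ∫ x in ε..δ, q x) (Set.uIcc 0 δ) := by
    refine intervalIntegral.continuousOn_primitive_interval_left ?_
    rw [Set.uIcc_of_le hδ.le]
    exact hq.integrableOn_Icc
  have h2 := h1 0 Set.left_mem_uIcc
  rw [Set.uIcc_of_le hδ.le] at h2
  exact (ContinuousWithinAt.mono_of_mem_nhdsWithin h2
    (mem_of_superset (Ioo_mem_nhdsGT hδ) Set.Ioo_subset_Icc_self))

/-- A function with a pole at `0+` has a finite part integral. -/
theorem exists_hasFinitePartAtZero_integral {ι : Type*} {s : Finset ι} {H q : ℝ → ℂ} {δ : ℝ}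
    (hδ : 0 < δ) {c : ι → ℂ} {k : ι → ℕ} (hk : ∀ i ∈ s, 1 ≤ k i) (hq : Continuous q)
    (hH : ∀ x ∈ Set.Ioc 0 δ, H x = ∑ i ∈ s, c i * ((x : ℂ) ^ k i)⁻¹ + q x) :
    ∃ L, HasFinitePartAtZero (fun ε => ∫ x in ε..δ, H x) L := by
  have hp : ∀ i ∈ s, ∃ L, HasFinitePartAtZero (fun ε => ∫ x in ε..δ, ((x : ℂ) ^ k i)⁻¹) L := by
    intro i hi
    rcases (hk i hi).eq_or_lt with h | h
    · exact ⟨_, by simpa [← h] using hasFinitePartAtZero_integral_inv hδ⟩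
    · exact ⟨_, hasFinitePartAtZero_integral_inv_pow hδ h⟩
  choose! L hL using hp
  refine ⟨_, ((HasFinitePartAtZero.sum _ fun i hi => (hL i hi).const_mul (c i)).add
    (hasFinitePartAtZero_of_tendsto
      (tendsto_integral_nhdsGT_zero hδ hq.continuousOn))).congr' ?_⟩
  filter_upwards [Ioo_mem_nhdsGT hδ] with ε hε
  have hi : ∀ i ∈ s, IntervalIntegrable (fun x : ℝ => c i * ((x : ℂ) ^ k i)⁻¹) volume ε δ :=
    fun i _ => (intervalIntegrable_inv_pow hε.1 hδ (k i)).const_mul _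
  have hs : IntervalIntegrable (fun x : ℝ => ∑ i ∈ s, c i * ((x : ℂ) ^ k i)⁻¹) volume ε δ := by
    simpa only [Finset.sum_fn] using IntervalIntegrable.sum _ hi
  rw [intervalIntegral.integral_congr (f := H) (g := fun x : ℝ =>
    ∑ i ∈ s, c i * ((x : ℂ) ^ k i)⁻¹ + q x), intervalIntegral.integral_add hs
      (hq.intervalIntegrable _ _), intervalIntegral.integral_finsetSum hi]
  · simp only [intervalIntegral.integral_const_mul]
  · intro x hx
    rw [Set.uIcc_of_le hε.2.le] at hx
    exact hH x ⟨hε.1.trans_le hx.1, hx.2⟩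

/-! ### Lattice sums -/

/-- The Eisenstein series `∑_{l ∈ ℤ} (z + l)⁻ᵏ`, of period one. At an integer the term with a
vanishing denominator contributes `0⁻¹ = 0`, so that the value there is the regular part. -/
noncomputable def latticeSum (k : ℕ) (z : ℂ) : ℂ := ∑' l : ℤ, ((z + l) ^ k)⁻¹

/-- The part of `latticeSum k` that is regular at the origin: the sum over the nonzero integers. -/
noncomputable def latticeRegular (k : ℕ) (z : ℂ) : ℂ :=
  ∑' l : ℤ, if l = 0 then 0 else ((z + l) ^ k)⁻¹

theorem latticeSum_zero {k : ℕ} (hk : 2 ≤ k) (he : Even k) :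
    latticeSum k 0 = 2 * riemannZeta k := by
  simp [latticeSum, two_mul_riemannZeta_eq_tsum_int_inv_pow_of_even hk he]

theorem latticeSum_add_one (k : ℕ) (z : ℂ) : latticeSum k (z + 1) = latticeSum k z := by
  rw [latticeSum, latticeSum, ← (Equiv.addRight (1 : ℤ)).tsum_eq fun l : ℤ => ((z + l) ^ k)⁻¹]
  refine tsum_congr fun l => ?_
  simp only [Equiv.coe_addRight]
  push_cast
  ring_nf

theorem latticeSum_neg {k : ℕ} (he : Even k) (z : ℂ) : latticeSum k (-z) = latticeSum k z := by
  rw [latticeSum, latticeSum, ← (Equiv.neg ℤ).tsum_eq]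
  refine tsum_congr fun l => ?_
  simp only [Equiv.neg_apply]
  push_cast
  rw [← neg_add, he.neg_pow]

theorem summable_lattice_bound {k : ℕ} (hk : 2 ≤ k) :
    Summable fun l : ℤ => (4 : ℝ) ^ k * |(1 : ℝ) / (l : ℝ) ^ k| :=
  ((Real.summable_one_div_int_pow.2 (by omega)).abs).mul_left _

theorem norm_lattice_term_le (k : ℕ) (l : ℤ) {w : ℂ} (hw : w ∈ Metric.ball (0 : ℂ) (3 / 4)) :
    ‖if l = 0 then (0 : ℂ) else ((w + l) ^ k)⁻¹‖ ≤ (4 : ℝ) ^ k * |(1 : ℝ) / (l : ℝ) ^ k| := by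
  split_ifs with hl
  · rw [norm_zero]; positivity
  · have h1 : (1 : ℝ) ≤ |(l : ℝ)| := by exact_mod_cast Int.one_le_abs hl
    have h2 : ‖w‖ < 3 / 4 := by simpa using hw
    have h3 : |(l : ℝ)| ≤ ‖w + l‖ + ‖w‖ := by
      have := norm_sub_le (w + l) w
      simpa using this
    have h4 : |(l : ℝ)| / 4 ≤ ‖w + l‖ := by linarith
    rw [norm_inv, norm_pow, abs_div, abs_one, abs_pow]
    calc (‖w + l‖ ^ k)⁻¹ ≤ ((|(l : ℝ)| / 4) ^ k)⁻¹ := by gcongr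
      _ = _ := by rw [div_pow, inv_div]; ring

theorem summable_latticeRegular {k : ℕ} (hk : 2 ≤ k) {w : ℂ}
    (hw : w ∈ Metric.ball (0 : ℂ) (3 / 4)) :
    Summable fun l : ℤ => if l = 0 then (0 : ℂ) else ((w + l) ^ k)⁻¹ :=
  .of_norm_bounded (summable_lattice_bound hk) fun l => norm_lattice_term_le k l hw

theorem latticeSum_eq_add_latticeRegular {k : ℕ} (hk : 2 ≤ k) {w : ℂ}
    (hw : w ∈ Metric.ball (0 : ℂ) (3 / 4)) :
    latticeSum k w = (w ^ k)⁻¹ + latticeRegular k w := by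
  have h := (summable_latticeRegular hk hw).hasSum.add (hasSum_ite_eq (0 : ℤ) (w ^ k)⁻¹)
  rw [latticeSum, latticeRegular, add_comm, ← h.tsum_eq]
  refine tsum_congr fun l => ?_
  by_cases hl : l = 0 <;> simp [hl]

theorem differentiableOn_latticeRegular {k : ℕ} (hk : 2 ≤ k) :
    DifferentiableOn ℂ (latticeRegular k) (Metric.ball 0 (3 / 4)) := by
  refine Complex.differentiableOn_tsum_of_summable_norm (summable_lattice_bound hk) (fun l w hw => ?_)
    Metric.isOpen_ball fun l w hw => norm_lattice_term_le k l hw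
  by_cases hl : l = 0
  · simpa [hl] using differentiableWithinAt_const _
  · simp only [hl, if_false]
    have hne : w + l ≠ 0 := by
      intro h
      have h1 : (1 : ℝ) ≤ |(l : ℝ)| := by exact_mod_cast Int.one_le_abs hl
      have h2 : ‖w‖ < 3 / 4 := by simpa using hw
      rw [eq_neg_of_add_eq_zero_left h] at h2
      simp at h2
      linarith
    have hd : DifferentiableAt ℂ (fun w : ℂ => (w + l) ^ k) w := by fun_prop
    exact (hd.inv (pow_ne_zero k hne)).differentiableWithinAt

theorem contDiffOn_latticeRegular {k : ℕ} (hk : 2 ≤ k) :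
    ContDiffOn ℝ ∞ (fun x : ℝ => latticeRegular k x) (Metric.ball 0 (3 / 4)) := by
  have h := ((differentiableOn_latticeRegular hk).contDiffOn (n := ∞)
    Metric.isOpen_ball).restrict_scalars ℝ
  refine h.comp Complex.ofRealCLM.contDiff.contDiffOn fun x hx => ?_
  simpa using hx

theorem contDiffAt_latticeSum {k : ℕ} (hk : 2 ≤ k) {x : ℝ} (hx : ∀ l : ℤ, x ≠ l) :
    ContDiffAt ℝ ∞ (fun x : ℝ => latticeSum k x) x := by
  have hperZ : ∀ (n : ℤ) (z : ℂ), latticeSum k (z + n) = latticeSum k z := fun n z => by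
    have h : Function.Periodic (latticeSum k) 1 := latticeSum_add_one k
    simpa using h.int_mul n z
  have hr := abs_sub_round x
  set y := x - round x with hy
  have hyb : y ∈ Metric.ball (0 : ℝ) (3 / 4) := by
    rw [mem_ball_zero_iff, Real.norm_eq_abs]; linarith
  have hy0 : y ≠ 0 := sub_ne_zero.2 (hx _)
  have h1 : ContDiffAt ℝ ∞ (fun x : ℝ => latticeSum k x) y := by
    have h2 : ContDiffAt ℝ ∞ (fun x : ℝ => ((x : ℂ) ^ k)⁻¹ + latticeRegular k x) y := by
      refine ContDiffAt.add (ContDiffAt.inv ?_ (pow_ne_zero _ (by exact_mod_cast hy0)))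
        ((contDiffOn_latticeRegular hk).contDiffAt (Metric.isOpen_ball.mem_nhds hyb))
      exact (Complex.ofRealCLM.contDiff.pow k).contDiffAt
    refine h2.congr_of_eventuallyEq ?_
    filter_upwards [Metric.isOpen_ball.mem_nhds hyb] with x hx
    exact latticeSum_eq_add_latticeRegular hk (by simpa using hx)
  have h3 : ContDiffAt ℝ ∞ ((fun x : ℝ => latticeSum k x) ∘ fun z => z - round x) x :=
    h1.comp x (contDiffAt_id.sub contDiffAt_const)
  refine h3.congr_of_eventuallyEq (Eventually.of_forall fun z => ?_)
  simp only [Function.comp]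
  rw [← hperZ (round x) ((z - round x : ℝ) : ℂ)]
  push_cast
  rw [sub_add_cancel]

/-- Grouping the integers by their residue modulo `n` evaluates the sum over a grid exactly. -/
theorem sum_latticeSum_div {k : ℕ} (hk : 2 ≤ k) (he : Even k) {n : ℕ} (hn : 1 ≤ n) :
    ∑ j ∈ Finset.range n, latticeSum k (j / n) = (n : ℂ) ^ k * (2 * riemannZeta k) := by
  have : NeZero n := ⟨by omega⟩
  have hn0 : (n : ℂ) ≠ 0 := by exact_mod_cast (by omega : n ≠ 0)
  have hsZ : Summable fun q : ℤ => ((q : ℂ) ^ k)⁻¹ := by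
    refine .of_norm ?_
    have := (Real.summable_one_div_int_pow (p := k).2 (by omega)).abs
    refine this.congr fun q => ?_
    simp
  obtain ⟨c, hc⟩ : ∃ c : ℤ × Fin n → ℂ,
      c = (fun q : ℤ => ((q : ℂ) ^ k)⁻¹) ∘ (Int.divModEquiv n).symm := ⟨_, rfl⟩
  have hsP : Summable c := by
    rw [hc]
    exact (Equiv.summable_iff _).2 hsZ
  have hterm : ∀ (j : Fin n) (l : ℤ),
      ((((j : ℕ) : ℂ) / n + l) ^ k)⁻¹ = (n : ℂ) ^ k * c (l, j) := by
    intro j l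
    have e : (((Int.divModEquiv n).symm (l, j) : ℤ) : ℂ) = n * (((j : ℕ) : ℂ) / n + l) := by
      rw [Int.divModEquiv_symm_apply]
      push_cast
      field_simp
      ring
    rw [hc, Function.comp_apply, e]
    rw [mul_pow, mul_inv, mul_inv_cancel_left₀ (pow_ne_zero k hn0)]
  have h1 : ∑' q : ℤ, ((q : ℂ) ^ k)⁻¹ = ∑ j : Fin n, ∑' l : ℤ, c (l, j) := by
    rw [← (Int.divModEquiv n).symm.tsum_eq fun q : ℤ => ((q : ℂ) ^ k)⁻¹]
    simp only [← Function.comp_apply (f := fun q : ℤ => ((q : ℂ) ^ k)⁻¹), ← hc]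
    rw [← (Equiv.prodComm (Fin n) ℤ).tsum_eq c, ← tsum_fintype (L := .unconditional _)]
    exact hsP.prod_symm.tsum_prod
  rw [two_mul_riemannZeta_eq_tsum_int_inv_pow_of_even hk he, h1, Finset.sum_range, Finset.mul_sum]
  refine Finset.sum_congr rfl fun j _ => ?_
  rw [latticeSum, ← tsum_mul_left]
  exact tsum_congr (hterm j)

/-- The regular part integrates over half a period to `∫_{1/2}^∞ x⁻ᵏ dx`: the intervals of
integration of the terms `l` and `-l` fit together to `[l - 1/2, l + 1/2]`. -/
theorem integral_latticeRegular {k : ℕ} (hk : 2 ≤ k) (he : Even k) :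
    ∫ x in (0 : ℝ)..(1 / 2), latticeRegular k x
      = (((1 / 2 : ℝ) : ℂ) ^ (k - 1))⁻¹ / ((k : ℂ) - 1) := by
  set I : ℤ → ℂ := fun l => ∫ x in (0 : ℝ)..(1 / 2),
    if l = 0 then (0 : ℂ) else ((((x : ℝ) : ℂ) + l) ^ k)⁻¹ with hI
  have hball : ∀ x ∈ Set.uIoc (0 : ℝ) (1 / 2), (x : ℂ) ∈ Metric.ball (0 : ℂ) (3 / 4) := by
    intro x hx
    rw [Set.uIoc_of_le (by norm_num)] at hx
    simp only [mem_ball_zero_iff, Complex.norm_real, Real.norm_of_nonneg hx.1.le]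
    linarith [hx.2]
  have hsum : HasSum I (∫ x in (0 : ℝ)..(1 / 2), latticeRegular k x) := by
    refine intervalIntegral.hasSum_integral_of_dominated_convergence
      (fun l _ => (4 : ℝ) ^ k * |(1 : ℝ) / (l : ℝ) ^ k|) (fun l => ?_) (fun l => ?_) ?_ ?_ ?_
    · refine Measurable.aestronglyMeasurable ?_
      by_cases hl : l = 0
      · simp [hl]
      · simp only [hl, if_false]; fun_prop
    · exact Eventually.of_forall fun x hx => norm_lattice_term_le k l (hball x hx)
    · exact Eventually.of_forall fun x _ => summable_lattice_bound hk
    · exact intervalIntegrable_const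
    · exact Eventually.of_forall fun x hx => (summable_latticeRegular hk (hball x hx)).hasSum
  have h0 : I 0 = 0 := by simp [hI]
  set A : ℕ → ℂ := fun n => (((n + 1 / 2 : ℝ) : ℂ) ^ (k - 1))⁻¹ / ((k : ℂ) - 1) with hA
  have hterm : ∀ n : ℕ, I (n + 1 : ℕ) + I (-(n + 1 : ℕ)) = A n - A (n + 1) := by
    intro n
    have e1 : I (n + 1 : ℕ) = ∫ x in (n + 1 : ℝ)..(n + 1 + 1 / 2), ((x : ℂ) ^ k)⁻¹ := by
      have := intervalIntegral.integral_comp_add_right (a := 0) (b := 1 / 2)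
        (fun x : ℝ => ((x : ℂ) ^ k)⁻¹) (n + 1 : ℝ)
      rw [zero_add, add_comm (1 / 2 : ℝ)] at this
      rw [← this]
      have hne : ((n + 1 : ℕ) : ℤ) ≠ 0 := by positivity
      simp only [hI, hne, if_false]
      push_cast; rfl
    have e2 : I (-(n + 1 : ℕ)) = ∫ x in (n + 1 / 2 : ℝ)..(n + 1), ((x : ℂ) ^ k)⁻¹ := by
      have := intervalIntegral.integral_comp_sub_left (a := 0) (b := 1 / 2)
        (fun x : ℝ => ((x : ℂ) ^ k)⁻¹) (n + 1 : ℝ)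
      rw [sub_zero, show (n + 1 - 1 / 2 : ℝ) = n + 1 / 2 by ring] at this
      rw [← this]
      have hne : -((n + 1 : ℕ) : ℤ) ≠ 0 := neg_ne_zero.2 (by positivity)
      simp only [hI, hne, if_false]
      refine intervalIntegral.integral_congr fun x _ => ?_
      rw [show (x : ℂ) + ((-((n + 1 : ℕ) : ℤ) : ℤ) : ℂ) = -((n + 1 - x : ℝ) : ℂ) by
        push_cast; ring, he.neg_pow]
    have hp : (0 : ℝ) < n + 1 / 2 := by positivity
    rw [e1, e2, add_comm, intervalIntegral.integral_add_adjacent_intervals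
      (intervalIntegrable_inv_pow hp (by positivity) k)
      (intervalIntegrable_inv_pow (by positivity) (by positivity) k),
      integral_inv_pow hp (by positivity) hk]
    simp only [hA]
    push_cast
    rw [sub_div]
  have hS := hsum.nat_add_neg.tendsto_sum_nat.comp (tendsto_add_atTop_nat 1)
  have hpart : ∀ N : ℕ, ∑ n ∈ Finset.range (N + 1), (I n + I (-n)) = A 0 - A N := by
    intro N
    rw [Finset.sum_range_succ']
    simp only [hterm, Nat.cast_zero, neg_zero, h0, add_zero]
    exact Finset.sum_range_sub' A N
  have hA0 : Tendsto A atTop (𝓝 0) := by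
    have h1 : Tendsto (fun n : ℕ => (n + 1 / 2 : ℝ)) atTop atTop :=
      tendsto_atTop_add_const_right _ _ tendsto_natCast_atTop_atTop
    have h2 := (tendsto_inv_atTop_zero.comp
      ((tendsto_pow_atTop (show k - 1 ≠ 0 by omega)).comp h1))
    have h3 := ((Complex.continuous_ofReal.tendsto 0).comp h2).div_const ((k : ℂ) - 1)
    simp only [Complex.ofReal_zero, zero_div] at h3
    refine h3.congr fun n => ?_
    simp [hA]
  have hS' : Tendsto (fun N => A 0 - A N) atTop (𝓝 (A 0 - 0)) := tendsto_const_nhds.sub hA0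
  have := tendsto_nhds_unique (hS.congr fun N => hpart N) hS'
  rw [h0, add_zero, sub_zero] at this
  rw [this]
  simp [hA]

/-! ### Removing the poles of a periodic function -/

theorem div_ne_intCast_of_mem_Ioo {T u : ℝ} (hT : 0 < T) (hu : u ∈ Set.Ioo 0 T) (l : ℤ) :
    u / T ≠ l := by
  intro h
  have h1 : (0 : ℝ) < l := h ▸ div_pos hu.1 hT
  have h2 : (l : ℝ) < 1 := h ▸ (div_lt_one hT).2 hu.2
  have h3 : 0 < l := by exact_mod_cast h1
  have h4 : l < 1 := by exact_mod_cast h2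
  omega

theorem contDiffAt_latticeSum_div {k : ℕ} (hk : 2 ≤ k) {T u : ℝ} (hu : ∀ l : ℤ, u / T ≠ l) :
    ContDiffAt ℝ ∞ (fun u : ℝ => latticeSum k (u / T : ℝ)) u :=
  (contDiffAt_latticeSum hk hu).comp u (contDiffAt_id.div_const T)

theorem continuousOn_latticeSum_div {k : ℕ} (hk : 2 ≤ k) {T : ℝ} (hT : 0 < T) :
    ContinuousOn (fun u : ℝ => latticeSum k (u / T : ℝ)) (Set.Ioo 0 T) := fun _ hu =>
  (contDiffAt_latticeSum_div hk
    (div_ne_intCast_of_mem_Ioo hT hu)).continuousAt.continuousWithinAt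

theorem ContinuousOn.intervalIntegrable_of_mem_Ioo {F : ℝ → ℂ} {T a b : ℝ}
    (hF : ContinuousOn F (Set.Ioo 0 T)) (ha : a ∈ Set.Ioo 0 T) (hb : b ∈ Set.Ioo 0 T) :
    IntervalIntegrable F volume a b :=
  (hF.mono (Set.ordConnected_Ioo.uIcc_subset ha hb)).intervalIntegrable

/-- The finite part of the integral of the lattice sum over a full period vanishes. -/
theorem hasFinitePartAtZero_integral_latticeSum {k : ℕ} (hk : 2 ≤ k) (he : Even k) {T : ℝ}
    (hT : 0 < T) :
    HasFinitePartAtZero (fun ε => ∫ u in ε..(T - ε), latticeSum k (u / T : ℝ)) 0 := by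
  have hT2 : 0 < T / 2 := by positivity
  have hTc : (T : ℂ) ≠ 0 := by exact_mod_cast hT.ne'
  have hball : ∀ u ∈ Set.Icc 0 (T / 2), u / T ∈ Metric.ball (0 : ℝ) (3 / 4) := by
    intro u hu
    have h1 : u / T ≤ 1 / 2 := by rw [div_le_iff₀ hT]; linarith [hu.2]
    rw [mem_ball_zero_iff, Real.norm_of_nonneg (div_nonneg hu.1 hT.le)]
    linarith
  have hballc : ∀ u ∈ Set.Icc 0 (T / 2), ((u / T : ℝ) : ℂ) ∈ Metric.ball (0 : ℂ) (3 / 4) := by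
    intro u hu
    simpa using hball u hu
  have hreg : ContinuousOn (fun u : ℝ => latticeRegular k (u / T : ℝ)) (Set.Icc 0 (T / 2)) :=
    (contDiffOn_latticeRegular hk).continuousOn.comp (by fun_prop) hball
  have hcont := continuousOn_latticeSum_div hk hT
  have h1 := ((hasFinitePartAtZero_integral_inv_pow hT2 hk).const_mul ((T : ℂ) ^ k)).add
    (hasFinitePartAtZero_of_tendsto (tendsto_integral_nhdsGT_zero hT2 hreg))
  have hval : (T : ℂ) ^ k * (-(((T / 2 : ℝ) : ℂ) ^ (k - 1))⁻¹ / ((k : ℂ) - 1))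
      + ∫ u in (0 : ℝ)..(T / 2), latticeRegular k (u / T : ℝ) = 0 := by
    have h2 := intervalIntegral.integral_comp_div (a := 0) (b := T / 2)
      (fun x : ℝ => latticeRegular k x) hT.ne'
    rw [h2, zero_div, show T / 2 / T = 1 / 2 by field_simp, integral_latticeRegular hk he,
      Complex.real_smul]
    obtain ⟨k, rfl⟩ := Nat.exists_eq_add_of_le' (show 1 ≤ k by omega)
    rw [Nat.add_sub_cancel, show T / 2 = T * (1 / 2) by ring, Complex.ofReal_mul, mul_pow,
      mul_inv, pow_succ]
    field_simp
    ring
  rw [hval] at h1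
  have h2 := h1.const_mul 2
  rw [mul_zero] at h2
  refine h2.congr' ?_
  filter_upwards [Ioo_mem_nhdsGT hT2] with ε hε
  have hε1 : ε ∈ Set.Ioo 0 T := ⟨hε.1, by linarith [hε.2]⟩
  have hε2 : T - ε ∈ Set.Ioo 0 T := ⟨by linarith [hε.2], by linarith [hε.1]⟩
  have hε3 : T / 2 ∈ Set.Ioo 0 T := ⟨hT2, by linarith⟩
  have hleft : ∫ u in ε..(T / 2), latticeSum k (u / T : ℝ)
      = (T : ℂ) ^ k * (∫ u in ε..(T / 2), ((u : ℂ) ^ k)⁻¹)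
        + ∫ u in ε..(T / 2), latticeRegular k (u / T : ℝ) := by
    rw [← intervalIntegral.integral_const_mul, ← intervalIntegral.integral_add
      ((intervalIntegrable_inv_pow hε.1 hT2 k).const_mul _)]
    · refine intervalIntegral.integral_congr fun u hu => ?_
      rw [Set.uIcc_of_le hε.2.le] at hu
      rw [latticeSum_eq_add_latticeRegular hk (hballc u ⟨hε.1.le.trans hu.1, hu.2⟩)]
      congr 1
      push_cast
      rw [div_pow, inv_div]
      ring
    · refine (hreg.mono ?_).intervalIntegrable
      rw [Set.uIcc_of_le hε.2.le]
      exact Set.Icc_subset_Icc_left hε.1.le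
  have hright : ∫ u in (T / 2)..(T - ε), latticeSum k (u / T : ℝ)
      = ∫ u in ε..(T / 2), latticeSum k (u / T : ℝ) := by
    have h3 := intervalIntegral.integral_comp_sub_left (a := ε) (b := T / 2)
      (fun u : ℝ => latticeSum k (u / T : ℝ)) T
    rw [show T - T / 2 = T / 2 by ring] at h3
    rw [← h3]
    refine intervalIntegral.integral_congr fun u _ => ?_
    rw [← latticeSum_neg he, ← latticeSum_add_one]
    congr 1
    push_cast
    field_simp
    ring
  rw [← intervalIntegral.integral_add_adjacent_intervals
    (hcont.intervalIntegrable_of_mem_Ioo hε1 hε3) (hcont.intervalIntegrable_of_mem_Ioo hε3 hε2),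
    hright, hleft]
  ring

section Decomposition

variable {T δ : ℝ} {H p : ℝ → ℂ} {ι : Type*} {s : Finset ι} {a : ι → ℂ} {k : ι → ℕ}

theorem isOpen_div_ne_intCast (T : ℝ) : IsOpen {u : ℝ | ∀ l : ℤ, u / T ≠ l} := by
  have h := Int.isClosedEmbedding_coe_real.isClosed_range.isOpen_compl.preimage
    (show Continuous fun u : ℝ => u / T by fun_prop)
  convert h using 1
  ext u
  simp [eq_comm]

/-- Subtracting lattice sums removes all poles of a periodic function with even polar part. -/
theorem exists_contDiff_periodic_sub_latticeSum (hT : 0 < T) (hδ : 0 < δ)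
    (hk : ∀ i ∈ s, 2 ≤ k i) (he : ∀ i ∈ s, Even (k i)) (hp : ContDiff ℝ ∞ p)
    (hper : ∀ u : ℝ, (∀ l : ℤ, u / T ≠ l) → H (u + T) = H u)
    (hsm : ∀ u : ℝ, (∀ l : ℤ, u / T ≠ l) → ContDiffAt ℝ ∞ H u)
    (hH : ∀ u : ℝ, u ≠ 0 → |u| < δ → H u = ∑ i ∈ s, a i * ((u : ℂ) ^ k i)⁻¹ + p u) :
    ∃ G : ℝ → ℂ, ContDiff ℝ ∞ G ∧ Function.Periodic G T ∧
      G 0 = p 0 - ∑ i ∈ s, a i / (T : ℂ) ^ k i * (2 * riemannZeta (k i)) ∧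
      ∀ u : ℝ, (∀ l : ℤ, u / T ≠ l) →
        H u = G u + ∑ i ∈ s, a i / (T : ℂ) ^ k i * latticeSum (k i) (u / T : ℝ) := by
  classical
  have hTc : (T : ℂ) ≠ 0 := by exact_mod_cast hT.ne'
  set S : ℝ → ℂ := fun u => ∑ i ∈ s, a i / (T : ℂ) ^ k i * latticeSum (k i) (u / T : ℝ) with hS
  set G : ℝ → ℂ := fun u => (if ∀ l : ℤ, u / T ≠ l then H u else p 0) - S u with hG
  have hshift : ∀ u : ℝ, (∀ l : ℤ, (u + T) / T ≠ l) ↔ ∀ l : ℤ, u / T ≠ l := by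
    intro u
    rw [add_div, div_self hT.ne']
    constructor
    · intro h l hl
      exact h (l + 1) (by rw [hl]; push_cast; ring)
    · intro h l hl
      exact h (l - 1) (by push_cast; rw [← hl]; ring)
  have hSper : Function.Periodic S T := by
    intro u
    simp only [hS]
    refine Finset.sum_congr rfl fun i _ => ?_
    rw [add_div, div_self hT.ne', Complex.ofReal_add, Complex.ofReal_one, latticeSum_add_one]
  have hGper : Function.Periodic G T := by
    intro u
    simp only [hG, hSper u]
    by_cases hu : ∀ l : ℤ, u / T ≠ l
    · rw [if_pos ((hshift u).2 hu), if_pos hu, hper u hu]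
    · rw [if_neg (mt (hshift u).1 hu), if_neg hu]
  have hG0 : ContDiffAt ℝ ∞ G 0 := by
    have h1 : ContDiffAt ℝ ∞ (fun u => p u -
        ∑ i ∈ s, a i / (T : ℂ) ^ k i * latticeRegular (k i) (u / T : ℝ)) 0 := by
      refine hp.contDiffAt.sub (ContDiffAt.sum fun i hi => contDiffAt_const.mul ?_)
      have h2 : ContDiffAt ℝ ∞ (fun x : ℝ => latticeRegular (k i) x) (0 / T) :=
        (contDiffOn_latticeRegular (hk i hi)).contDiffAt
          (Metric.isOpen_ball.mem_nhds (by rw [zero_div]; exact Metric.mem_ball_self (by norm_num)))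
      exact ContDiffAt.comp (0 : ℝ) h2 (contDiffAt_id.div_const T)
    refine h1.congr_of_eventuallyEq ?_
    have hr : 0 < min δ (T / 2) := lt_min hδ (by positivity)
    filter_upwards [Metric.ball_mem_nhds (0 : ℝ) hr] with u hu
    rw [mem_ball_zero_iff, Real.norm_eq_abs, lt_min_iff] at hu
    have hb : |u / T| < 1 / 2 := by
      rw [abs_div, abs_of_pos hT, div_lt_iff₀ hT]; linarith [hu.2]
    have hbc : ((u / T : ℝ) : ℂ) ∈ Metric.ball (0 : ℂ) (3 / 4) := by
      rw [mem_ball_zero_iff, Complex.norm_real, Real.norm_eq_abs]; linarith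
    have hSu : S u = ∑ i ∈ s, a i * ((u : ℂ) ^ k i)⁻¹ +
        ∑ i ∈ s, a i / (T : ℂ) ^ k i * latticeRegular (k i) (u / T : ℝ) := by
      rw [← Finset.sum_add_distrib]
      refine Finset.sum_congr rfl fun i hi => ?_
      rw [latticeSum_eq_add_latticeRegular (hk i hi) hbc, mul_add]
      congr 1
      push_cast
      rw [div_pow, inv_div]
      field_simp
    simp only [hG, hSu]
    by_cases hu0 : u = 0
    · subst hu0
      rw [if_neg (by push Not; exact ⟨0, by simp⟩), Finset.sum_eq_zero (s := s)
        (f := fun i => a i * (((0 : ℝ) : ℂ) ^ k i)⁻¹), zero_add]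
      intro i hi
      have := hk i hi
      simp [show k i ≠ 0 by omega]
    · have hl : ∀ l : ℤ, u / T ≠ l := by
        intro l hl
        rw [hl] at hb
        have h3 : |l| < 1 := by
          have : |(l : ℝ)| < 1 := by linarith
          exact_mod_cast this
        rw [Int.abs_lt_one_iff.1 h3, Int.cast_zero, div_eq_zero_iff] at hl
        exact hl.elim hu0 hT.ne'
      rw [if_pos hl, hH u hu0 hu.1]
      ring
  refine ⟨G, contDiff_iff_contDiffAt.2 fun u => ?_, hGper, ?_, fun u hu => ?_⟩
  · by_cases hu : ∀ l : ℤ, u / T ≠ l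
    · have h1 : ContDiffAt ℝ ∞ (fun u => H u - S u) u :=
        (hsm u hu).sub (ContDiffAt.sum fun i hi =>
          contDiffAt_const.mul (contDiffAt_latticeSum_div (hk i hi) hu))
      refine h1.congr_of_eventuallyEq ?_
      filter_upwards [(isOpen_div_ne_intCast T).mem_nhds hu] with v hv
      simp only [hG]
      rw [if_pos hv]
    · push Not at hu
      obtain ⟨l, hl⟩ := hu
      have hul : u - l * T = 0 := by
        rw [div_eq_iff hT.ne'] at hl
        rw [hl, sub_self]
      have h1 : ContDiffAt ℝ ∞ (G ∘ fun v => v - l * T) u :=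
        ContDiffAt.comp u (by rw [hul]; exact hG0) (contDiffAt_id.sub contDiffAt_const)
      exact h1.congr_of_eventuallyEq (Eventually.of_forall fun v => (hGper.sub_int_mul_eq l).symm)
  · simp only [hG, hS]
    rw [if_neg (by push Not; exact ⟨0, by simp⟩)]
    congr 1
    refine Finset.sum_congr rfl fun i hi => ?_
    rw [zero_div, Complex.ofReal_zero, latticeSum_zero (hk i hi) (he i hi)]
  · simp only [hG]
    rw [if_pos hu]
    ring

theorem mesh_pos {T : ℝ} (hT : 0 < T) {n : ℕ} (hn : 1 ≤ n) : 0 < mesh T n :=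
  div_pos hT (by exact_mod_cast hn)

theorem natCast_mul_mesh (T : ℝ) {n : ℕ} (hn : 1 ≤ n) : n * mesh T n = T :=
  mul_div_cancel₀ T (by exact_mod_cast (by omega : n ≠ 0))

theorem mul_mesh_mem_Ioo {T : ℝ} (hT : 0 < T) {n j : ℕ} (hj : j ∈ Finset.Ico 1 n) :
    (j : ℝ) * mesh T n ∈ Set.Ioo 0 T := by
  obtain ⟨h1, h2⟩ := Finset.mem_Ico.1 hj
  have hm := mesh_pos hT (show 1 ≤ n by omega)
  refine ⟨mul_pos (by exact_mod_cast h1) hm, ?_⟩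
  calc (j : ℝ) * mesh T n < n * mesh T n := by
        apply mul_lt_mul_of_pos_right _ hm; exact_mod_cast h2
    _ = T := natCast_mul_mesh T (by omega)

/-- The punctured sum of a function decomposed into a regular function and lattice sums. -/
theorem mesh_mul_sum_eq {G : ℝ → ℂ} (hT : 0 < T) (hk : ∀ i ∈ s, 2 ≤ k i)
    (he : ∀ i ∈ s, Even (k i))
    (hG0 : G 0 = p 0 - ∑ i ∈ s, a i / (T : ℂ) ^ k i * (2 * riemannZeta (k i)))
    (hGH : ∀ u : ℝ, (∀ l : ℤ, u / T ≠ l) →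
        H u = G u + ∑ i ∈ s, a i / (T : ℂ) ^ k i * latticeSum (k i) (u / T : ℝ))
    {n : ℕ} (hn : 1 ≤ n) :
    (mesh T n : ℂ) * ∑ j ∈ Finset.Ico 1 n, H (j * mesh T n)
      = (mesh T n : ℂ) * ∑ j ∈ Finset.range n, G (j * mesh T n) - mesh T n * p 0
        + ∑ i ∈ s, a i * (2 * riemannZeta (k i)) * (mesh T n : ℂ) ^ (1 - (k i : ℤ)) := by
  have hn0 : (n : ℂ) ≠ 0 := by exact_mod_cast (by omega : n ≠ 0)
  have hTc : (T : ℂ) ≠ 0 := by exact_mod_cast hT.ne'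
  have hmc : (mesh T n : ℂ) ≠ 0 := by exact_mod_cast (mesh_pos hT hn).ne'
  have hdiv : ∀ j : ℕ, j * mesh T n / T = (j : ℝ) / n := fun j => by
    rw [mesh]; field_simp
  have h1 : ∑ j ∈ Finset.Ico 1 n, H (j * mesh T n) = ∑ j ∈ Finset.Ico 1 n, G (j * mesh T n) +
      ∑ i ∈ s, a i / (T : ℂ) ^ k i * ∑ j ∈ Finset.Ico 1 n, latticeSum (k i) (j / n) := by
    simp only [Finset.mul_sum]
    rw [Finset.sum_comm, ← Finset.sum_add_distrib]
    refine Finset.sum_congr rfl fun j hj => ?_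
    rw [hGH _ (div_ne_intCast_of_mem_Ioo hT (mul_mesh_mem_Ioo hT hj)), hdiv]
    push_cast
    rfl
  have h2 : ∀ i ∈ s, ∑ j ∈ Finset.Ico 1 n, latticeSum (k i) (j / n)
      = ((n : ℂ) ^ k i - 1) * (2 * riemannZeta (k i)) := by
    intro i hi
    have h3 := sum_latticeSum_div (hk i hi) (he i hi) hn
    rw [Finset.range_eq_Ico, Finset.sum_eq_sum_Ico_succ_bot (by omega)] at h3
    rw [Nat.cast_zero, zero_div, latticeSum_zero (hk i hi) (he i hi)] at h3
    linear_combination h3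
  have h4 : ∑ j ∈ Finset.range n, G (j * mesh T n)
      = G 0 + ∑ j ∈ Finset.Ico 1 n, G (j * mesh T n) := by
    rw [Finset.range_eq_Ico, Finset.sum_eq_sum_Ico_succ_bot (by omega)]
    simp
  have h6 : ∑ i ∈ s, a i / (T : ℂ) ^ k i * ∑ j ∈ Finset.Ico 1 n, latticeSum (k i) (j / n)
      = ∑ i ∈ s, a i / (T : ℂ) ^ k i * (((n : ℂ) ^ k i - 1) * (2 * riemannZeta (k i))) :=
    Finset.sum_congr rfl fun i hi => by rw [h2 i hi]
  rw [h1, h4, hG0, h6]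
  have h5 : ∀ i ∈ s, a i * (2 * riemannZeta (k i)) * (mesh T n : ℂ) ^ (1 - (k i : ℤ))
      = mesh T n * (a i / (T : ℂ) ^ k i * ((n : ℂ) ^ k i * (2 * riemannZeta (k i)))) := by
    intro i _
    rw [zpow_sub₀ hmc, zpow_one, zpow_natCast]
    have : (mesh T n : ℂ) ^ k i = (T : ℂ) ^ k i / (n : ℂ) ^ k i := by
      rw [mesh, ← div_pow]; push_cast; rfl
    rw [this]
    field_simp
  rw [Finset.sum_congr rfl h5, ← Finset.mul_sum]
  simp only [sub_mul, one_mul, mul_sub, Finset.sum_sub_distrib]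
  ring

theorem hasFinitePartAtZero_integral_of_decomposition {G : ℝ → ℂ} (hT : 0 < T)
    (hk : ∀ i ∈ s, 2 ≤ k i) (he : ∀ i ∈ s, Even (k i)) (hG : Continuous G)
    (hGH : ∀ u : ℝ, (∀ l : ℤ, u / T ≠ l) →
        H u = G u + ∑ i ∈ s, a i / (T : ℂ) ^ k i * latticeSum (k i) (u / T : ℝ)) :
    HasFinitePartAtZero (fun ε => ∫ u in ε..(T - ε), H u) (∫ u in (0 : ℝ)..T, G u) := by
  have h1 : HasFinitePartAtZero (fun ε => ∫ u in ε..(T - ε), G u) (∫ u in (0 : ℝ)..T, G u) := by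
    have hc : Continuous fun x => ∫ u in (0 : ℝ)..x, G u :=
      intervalIntegral.continuous_primitive (fun a b => hG.intervalIntegrable a b) 0
    have h2 : Continuous fun ε => (∫ u in (0 : ℝ)..(T - ε), G u) - ∫ u in (0 : ℝ)..ε, G u :=
      (hc.comp (by fun_prop : Continuous fun ε : ℝ => T - ε)).sub hc
    have h3 := (h2.tendsto 0).mono_left (nhdsWithin_le_nhds (s := Set.Ioi 0))
    rw [sub_zero, intervalIntegral.integral_same, sub_zero] at h3
    refine hasFinitePartAtZero_of_tendsto (h3.congr fun ε => ?_)
    exact intervalIntegral.integral_interval_sub_left (hG.intervalIntegrable _ _)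
      (hG.intervalIntegrable _ _)
  have h2 := h1.add (HasFinitePartAtZero.sum s fun i hi =>
    (hasFinitePartAtZero_integral_latticeSum (hk i hi) (he i hi) hT).const_mul
      (a i / (T : ℂ) ^ k i))
  simp only [mul_zero, Finset.sum_const_zero, add_zero] at h2
  refine h2.congr' ?_
  filter_upwards [Ioo_mem_nhdsGT (show 0 < T / 2 by positivity)] with ε hε
  have hε1 : ε ∈ Set.Ioo 0 T := ⟨hε.1, by linarith [hε.1, hε.2]⟩
  have hε2 : T - ε ∈ Set.Ioo 0 T := ⟨by linarith [hε.2], by linarith [hε.1]⟩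
  have hi : ∀ i ∈ s, IntervalIntegrable
      (fun u : ℝ => a i / (T : ℂ) ^ k i * latticeSum (k i) (u / T : ℝ)) volume ε (T - ε) :=
    fun i hi => ((continuousOn_latticeSum_div (hk i hi) hT).intervalIntegrable_of_mem_Ioo
      hε1 hε2).const_mul _
  have hs : IntervalIntegrable (fun u : ℝ => ∑ i ∈ s, a i / (T : ℂ) ^ k i *
      latticeSum (k i) (u / T : ℝ)) volume ε (T - ε) := by
    simpa only [Finset.sum_fn] using IntervalIntegrable.sum _ hi
  rw [intervalIntegral.integral_congr (f := H) (g := fun u : ℝ => G u +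
    ∑ i ∈ s, a i / (T : ℂ) ^ k i * latticeSum (k i) (u / T : ℝ)),
    intervalIntegral.integral_add (hG.intervalIntegrable _ _) hs,
    intervalIntegral.integral_finsetSum hi]
  · simp only [intervalIntegral.integral_const_mul]
  · intro u hu
    exact hGH u (div_ne_intCast_of_mem_Ioo hT (Set.ordConnected_Ioo.uIcc_subset hε1 hε2 hu))

end Decomposition

/-! ### Local expansion at the singularity -/

theorem mem_puncturedLine_iff {t T : ℝ} (hT : 0 < T) (u : ℝ) :
    t + u ∈ puncturedLine t T ↔ ∀ l : ℤ, u / T ≠ l := by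
  simp only [puncturedLine, Set.mem_ofPred_eq, ne_eq, add_right_inj, div_eq_iff hT.ne']

theorem isOpen_puncturedLine {t T : ℝ} (hT : 0 < T) : IsOpen (puncturedLine t T) := by
  have h := (isOpen_div_ne_intCast T).preimage (show Continuous fun x : ℝ => x - t by fun_prop)
  convert h using 1
  ext x
  rw [← add_sub_cancel t x, mem_puncturedLine_iff hT]
  simp

/-- Local Taylor expansion with smooth quotient for a function that is only smooth on an
interval, by multiplication with a smooth cutoff. -/
theorem exists_contDiff_taylor_quotient_on_Icc {a b t : ℝ} (hat : a < t) (htb : t < b)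
    {g : ℝ → ℂ} (hg : ContDiffOn ℝ ∞ g (Set.Icc a b)) (m : ℕ) :
    ∃ δ > 0, δ < t - a ∧ δ < b - t ∧ ∃ q : ℝ → ℂ, ContDiff ℝ ∞ q ∧
      q 0 = iteratedDeriv m g t / (m.factorial : ℂ) ∧
      ∀ u : ℝ, |u| ≤ δ → g (t + u) =
        ∑ j ∈ Finset.range m, iteratedDeriv j g t / (j.factorial : ℂ) * (u : ℂ) ^ j
          + (u : ℂ) ^ m * q u := by
  have hρ : 0 < min (t - a) (b - t) := lt_min (sub_pos.2 hat) (sub_pos.2 htb)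
  set ρ := min (t - a) (b - t) with hρdef
  let χ : ContDiffBump t := ⟨ρ / 3, ρ / 2, by positivity, by linarith⟩
  have hsub : Metric.closedBall t (ρ / 2) ⊆ Set.Ioo a b := by
    intro x hx
    have h1 := min_le_left (t - a) (b - t)
    have h2 := min_le_right (t - a) (b - t)
    rw [Metric.mem_closedBall, Real.dist_eq, abs_le] at hx
    constructor <;> linarith [hx.1, hx.2]
  have hG : ContDiff ℝ ∞ fun x => χ x • g x := by
    refine contDiff_iff_contDiffAt.2 fun x => ?_
    by_cases hx : x ∈ tsupport fun x => χ x • g x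
    swap
    · exact contDiffAt_const.congr_of_eventuallyEq (notMem_tsupport_iff_eventuallyEq.1 hx)
    have hx1 : x ∈ Set.Ioo a b := hsub (by
      have := tsupport_smul_subset_left χ g hx
      rwa [χ.tsupport_eq] at this)
    exact χ.contDiff.contDiffAt.smul
      (hg.contDiffAt (mem_of_superset (Ioo_mem_nhds hx1.1 hx1.2) Set.Ioo_subset_Icc_self))
  have hh : ContDiff ℝ ∞ fun u => χ (t + u) • g (t + u) :=
    hG.comp (contDiff_const.add contDiff_id)
  have heq : ∀ u : ℝ, |u| ≤ ρ / 3 → χ (t + u) • g (t + u) = g (t + u) := by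
    intro u hu
    rw [χ.one_of_mem_closedBall (by simpa [χ] using hu), one_smul]
  have hderiv : ∀ j, iteratedDeriv j (fun u => χ (t + u) • g (t + u)) 0
      = iteratedDeriv j g t := by
    intro j
    have h1 : (fun u => χ (t + u) • g (t + u)) =ᶠ[𝓝 0] fun u => g (t + u) := by
      filter_upwards [Metric.closedBall_mem_nhds (0 : ℝ) (show 0 < ρ / 3 by positivity)] with u hu
      exact heq u (by simpa using hu)
    rw [h1.iteratedDeriv_eq, iteratedDeriv_comp_const_add]
    simp
  obtain ⟨q, hq, hq0, hqe⟩ := exists_contDiff_taylor_quotient m hh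
  simp only [hderiv] at hq0 hqe
  have h1 := min_le_left (t - a) (b - t)
  have h2 := min_le_right (t - a) (b - t)
  refine ⟨ρ / 3, by positivity, by linarith, by linarith, q, hq, hq0, fun u hu => ?_⟩
  rw [← hqe u, heq u hu]

theorem sum_range_two_mul (w : ℕ → ℂ) (r : ℕ) :
    ∑ j ∈ Finset.range (2 * r), w j = ∑ i ∈ Finset.range r, (w (2 * i) + w (2 * i + 1)) := by
  induction r with
  | zero => simp
  | succ r ih =>
    rw [Finset.sum_range_succ _ r, ← ih, show 2 * (r + 1) = 2 * r + 1 + 1 by ring,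
      Finset.sum_range_succ, Finset.sum_range_succ]
    ring

/-- A sum supported on the indices of the same parity as its length. -/
theorem sum_range_eq_of_parity (w : ℕ → ℂ) (m : ℕ) (hw : ∀ j < m, Odd (m - j) → w j = 0) :
    ∑ j ∈ Finset.range m, w j = ∑ i ∈ Finset.range (m / 2), w (2 * i + m % 2) := by
  obtain ⟨r, h⟩ : ∃ r, m = 2 * r ∨ m = 2 * r + 1 := ⟨m / 2, by omega⟩
  rcases h with rfl | rfl
  · rw [sum_range_two_mul, show 2 * r / 2 = r by omega, show 2 * r % 2 = 0 by omega]
    refine Finset.sum_congr rfl fun i hi => ?_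
    have := Finset.mem_range.1 hi
    rw [hw (2 * i + 1) (by omega) ⟨r - i - 1, by omega⟩, add_zero, add_zero]
  · rw [Finset.sum_range_succ', sum_range_two_mul, show (2 * r + 1) / 2 = r by omega,
      show (2 * r + 1) % 2 = 1 by omega, hw 0 (by omega) ⟨r, by omega⟩, add_zero]
    refine Finset.sum_congr rfl fun i hi => ?_
    have := Finset.mem_range.1 hi
    rw [hw (2 * i + 1 + 1) (by omega) ⟨r - i - 1, by omega⟩, add_zero]

/-- Taking the even part keeps the even polar terms only. -/
theorem even_part_polar_expansion {F q : ℝ → ℂ} {γ : ℕ → ℂ} {m : ℕ} {u : ℝ}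
    (h₁ : F u = ∑ j ∈ Finset.range m, γ j * ((u : ℂ) ^ (m - j))⁻¹ + q u)
    (h₂ : F (-u) = ∑ j ∈ Finset.range m, γ j * (((-u : ℝ) : ℂ) ^ (m - j))⁻¹ + q (-u)) :
    (F u + F (-u)) / 2 = ∑ i ∈ Finset.range (m / 2),
      γ (2 * i + m % 2) * ((u : ℂ) ^ (2 * (m / 2 - i)))⁻¹ + (q u + q (-u)) / 2 := by
  have h := sum_range_eq_of_parity
    (fun j => γ j * (((u : ℂ) ^ (m - j))⁻¹ + ((-(u : ℂ)) ^ (m - j))⁻¹) / 2) m fun j _ hj => by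
      simp only [hj.neg_pow, inv_neg, add_neg_cancel, mul_zero, zero_div]
  have h3 : ∀ i ∈ Finset.range (m / 2), γ (2 * i + m % 2) *
      (((u : ℂ) ^ (m - (2 * i + m % 2)))⁻¹ + ((-(u : ℂ)) ^ (m - (2 * i + m % 2)))⁻¹) / 2
      = γ (2 * i + m % 2) * ((u : ℂ) ^ (2 * (m / 2 - i)))⁻¹ := by
    intro i hi
    have := Finset.mem_range.1 hi
    rw [show m - (2 * i + m % 2) = 2 * (m / 2 - i) by omega, (even_two_mul _).neg_pow]
    ring
  rw [Finset.sum_congr rfl h3] at h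
  rw [← h, h₁, h₂, Complex.ofReal_neg]
  simp only [mul_add, add_div, Finset.sum_add_distrib, ← Finset.sum_div]
  ring

/-! ### Spectrally accurate sequences and combinations of rules -/

theorem spectrallyAccurate_of_isLittleO {Q : ℕ → ℂ} {I : ℂ}
    (h : ∀ μ : ℝ, 0 < μ → (fun n : ℕ => Q n - I) =o[atTop] (fun n : ℕ => (n : ℝ) ^ (-μ))) :
    SpectrallyAccurate Q I := by
  refine ⟨?_, h⟩
  have h1 := (h 1 one_pos).trans_tendsto
    ((tendsto_rpow_neg_atTop one_pos).comp tendsto_natCast_atTop_atTop)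
  simpa using h1.add_const I

theorem spectrallyAccurate_of_le_mesh_pow {Q : ℕ → ℂ} {I : ℂ} {T : ℝ}
    (h : ∀ K : ℕ, ∃ C : ℝ, ∀ n : ℕ, 1 ≤ n → ‖Q n - I‖ ≤ C * mesh T n ^ (K + 1)) :
    SpectrallyAccurate Q I := by
  refine spectrallyAccurate_of_isLittleO fun μ hμ => ?_
  obtain ⟨K, hK⟩ := exists_nat_gt μ
  obtain ⟨C, hC⟩ := h K
  have h1 : (fun n : ℕ => Q n - I) =O[atTop] fun n : ℕ => (n : ℝ) ^ (-((K + 1 : ℕ) : ℝ)) := by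
    refine IsBigO.of_bound (C * T ^ (K + 1)) ?_
    filter_upwards [eventually_ge_atTop 1] with n hn
    refine (hC n hn).trans_eq ?_
    rw [Real.rpow_neg n.cast_nonneg, Real.rpow_natCast, mesh, div_pow,
      Real.norm_of_nonneg (by positivity)]
    ring
  refine h1.trans_isLittleO ?_
  have h2 : Tendsto (fun n : ℕ => (n : ℝ) ^ (-(((K + 1 : ℕ) : ℝ) - μ))) atTop (𝓝 0) :=
    (tendsto_rpow_neg_atTop (by push_cast; linarith)).comp tendsto_natCast_atTop_atTop
  refine (isLittleO_of_tendsto' ?_ (h2.congr' ?_))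
  · filter_upwards [eventually_ge_atTop 1] with n hn h0
    have : (0 : ℝ) < n := by exact_mod_cast hn
    exact absurd h0 (Real.rpow_pos_of_pos this _).ne'
  · filter_upwards [eventually_ge_atTop 1] with n hn
    have : (0 : ℝ) < n := by exact_mod_cast hn
    rw [← Real.rpow_sub this]
    congr 1
    ring

namespace SpectrallyAccurate

variable {Q R : ℕ → ℂ} {I J : ℂ}

theorem congr (h : SpectrallyAccurate Q I) (hQR : ∀ n, 1 ≤ n → Q n = R n) (hIJ : I = J) :
    SpectrallyAccurate R J := by
  subst hIJ
  have he : Q =ᶠ[atTop] R := (eventually_ge_atTop 1).mono hQR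
  exact ⟨h.1.congr' he, fun μ hμ => (h.2 μ hμ).congr' (he.mono fun n hn => by simp only [hn]) .rfl⟩

theorem const_mul (h : SpectrallyAccurate Q I) (z : ℂ) :
    SpectrallyAccurate (fun n => z * Q n) (z * I) :=
  ⟨h.1.const_mul z, fun μ hμ => ((h.2 μ hμ).const_mul_left z).congr_left fun n => by ring⟩

theorem add (hQ : SpectrallyAccurate Q I) (hR : SpectrallyAccurate R J) :
    SpectrallyAccurate (fun n => Q n + R n) (I + J) :=
  ⟨hQ.1.add hR.1, fun μ hμ => ((hQ.2 μ hμ).add (hR.2 μ hμ)).congr_left fun n => by ring⟩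

theorem sum {ι : Type*} (s : Finset ι) {Q : ι → ℕ → ℂ} {I : ι → ℂ}
    (h : ∀ i ∈ s, SpectrallyAccurate (Q i) (I i)) :
    SpectrallyAccurate (fun n => ∑ i ∈ s, Q i n) (∑ i ∈ s, I i) := by
  classical
  induction s using Finset.induction_on with
  | empty => exact spectrallyAccurate_of_isLittleO fun μ _ => by simp
  | insert i s hi ih =>
    simp only [Finset.sum_insert hi]
    exact (h i (Finset.mem_insert_self _ _)).add
      (ih fun j hj => h j (Finset.mem_insert_of_mem hj))

theorem comp_mul (h : SpectrallyAccurate Q I) {c : ℕ} (hc : 1 ≤ c) :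
    SpectrallyAccurate (fun n => Q (c * n)) I := by
  have ht : Tendsto (fun n : ℕ => c * n) atTop atTop :=
    tendsto_id.const_mul_atTop' (by omega)
  refine spectrallyAccurate_of_isLittleO fun μ hμ =>
    ((h.2 μ hμ).comp_tendsto ht).trans_isBigO ?_
  refine IsBigO.of_bound 1 ?_
  filter_upwards [eventually_ge_atTop 1] with n hn
  have h1 : (0 : ℝ) < n := by exact_mod_cast hn
  have h2 : (n : ℝ) ≤ (c * n : ℕ) := by exact_mod_cast Nat.le_mul_of_pos_left n hc
  simp only [Function.comp, one_mul]
  rw [Real.norm_of_nonneg (by positivity), Real.norm_of_nonneg (by positivity)]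
  exact Real.rpow_le_rpow_of_nonpos h1 h2 (by linarith)

end SpectrallyAccurate

theorem mesh_mul (T : ℝ) (c n : ℕ) : mesh T (c * n) = mesh T n / c := by
  rw [mesh, mesh]
  push_cast
  rw [mul_comm, div_div]

theorem sum_Ico_two_mul (w : ℕ → ℂ) {n : ℕ} (hn : 1 ≤ n) :
    ∑ j ∈ Finset.Ico 1 (2 * n), w j
      = ∑ j ∈ Finset.Ico 1 n, w (2 * j) + ∑ j ∈ Finset.Icc 1 n, w (2 * j - 1) := by
  induction n, hn using Nat.le_induction with
  | base => simp
  | succ n hn ih =>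
    rw [show 2 * (n + 1) = 2 * n + 1 + 1 by ring, Finset.sum_Ico_succ_top (by omega),
      Finset.sum_Ico_succ_top (by omega), ih, Finset.sum_Ico_succ_top hn,
      Finset.sum_Icc_succ_top (by omega), show 2 * (n + 1) - 1 = 2 * n + 1 by omega]
    ring

/-- The midpoints are the odd nodes of the grid of half the step. -/
theorem midpointSum_eq (f : ℝ → ℂ) (t T : ℝ) {n : ℕ} (hn : 1 ≤ n) :
    midpointSum f t T n = 2 * trapezoidal f t T (2 * n) - trapezoidal f t T n := by
  have h1 : ∑ j ∈ Finset.Ico 1 n, f (t + ((2 * j : ℕ) : ℝ) * mesh T (2 * n))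
      = ∑ j ∈ Finset.Ico 1 n, f (t + j * mesh T n) := by
    refine Finset.sum_congr rfl fun j _ => ?_
    rw [mesh_mul]
    push_cast
    ring_nf
  have h2 : ∑ j ∈ Finset.Icc 1 n, f (t + ((2 * j - 1 : ℕ) : ℝ) * mesh T (2 * n))
      = ∑ j ∈ Finset.Icc 1 n, f (t + j * mesh T n - mesh T n / 2) := by
    refine Finset.sum_congr rfl fun j hj => ?_
    have := (Finset.mem_Icc.1 hj).1
    rw [mesh_mul, Nat.cast_sub (by omega)]
    push_cast
    ring_nf
  rw [midpointSum, trapezoidal, trapezoidal, sum_Ico_two_mul _ hn, h1, h2, mesh_mul]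
  push_cast
  ring

theorem two_zpow_odd_ne_one (s : ℤ) : (2 : ℂ) ^ (1 - 2 * s) ≠ 1 := by
  intro h
  have h1 : (2 : ℝ) ^ (1 - 2 * s) = 1 := by simpa [norm_zpow] using congrArg norm h
  rw [zpow_eq_one_iff_right₀ (by norm_num) (by norm_num)] at h1
  omega

theorem spectrallyAccurate_richardsonRule {f g : ℝ → ℂ} {t T : ℝ} {m : ℕ} {I : ℂ}
    (h : SpectrallyAccurate (correctedTrapezoidal f g t T m) I) (s : ℕ) :
    SpectrallyAccurate (richardsonRule f g t T m s) I := by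
  induction s with
  | zero => exact h
  | succ s ih =>
    have hz := sub_ne_zero.2 (two_zpow_odd_ne_one s)
    refine ((((ih.comp_mul one_le_two).const_mul ((2 : ℂ) ^ (1 - 2 * (s : ℤ)))).add
      (ih.const_mul (-1))).const_mul ((2 : ℂ) ^ (1 - 2 * (s : ℤ)) - 1)⁻¹).congr
      (fun n _ => ?_) ?_
    · rw [richardsonRule]
      ring
    · field_simp
      ring

theorem spectrallyAccurate_combination {Q : ℕ → ℂ} {I : ℂ} (h : SpectrallyAccurate Q I) {s : ℕ}
    {α : ℕ → ℂ} (hα : ∑ k ∈ Finset.range (s + 1), α k = 1) :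
    SpectrallyAccurate (fun n => ∑ k ∈ Finset.range (s + 1), α k * Q (2 ^ k * n)) I := by
  refine (SpectrallyAccurate.sum _ fun k _ =>
    (h.comp_mul (c := 2 ^ k) Nat.one_le_two_pow).const_mul (α k)).congr (fun n _ => rfl) ?_
  rw [← Finset.sum_mul, hα, one_mul]

section ExplicitRules

variable {f g : ℝ → ℂ} {t T : ℝ} {I : ℂ}

theorem correctedTrapezoidal_one (n : ℕ) : correctedTrapezoidal f g t T 1 n
    = trapezoidal f t T n + deriv g t * mesh T n := by
  rw [correctedTrapezoidal]
  simp [riemannZeta_zero]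
  ring

theorem correctedTrapezoidal_two (n : ℕ) : correctedTrapezoidal f g t T 2 n
    = trapezoidal f t T n - (Real.pi : ℂ) ^ 2 / 3 * g t * (mesh T n : ℂ)⁻¹
      + 1 / 2 * iteratedDeriv 2 g t * mesh T n := by
  rw [correctedTrapezoidal]
  simp [Finset.sum_range_succ, riemannZeta_zero, riemannZeta_two]
  ring

theorem correctedTrapezoidal_three (n : ℕ) : correctedTrapezoidal f g t T 3 n
    = trapezoidal f t T n - (Real.pi : ℂ) ^ 2 / 3 * deriv g t * (mesh T n : ℂ)⁻¹
      + 1 / 6 * iteratedDeriv 3 g t * mesh T n := by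
  rw [correctedTrapezoidal]
  simp [Finset.sum_range_succ, riemannZeta_zero, riemannZeta_two, Nat.factorial]
  ring

theorem correctedTrapezoidal_four (n : ℕ) : correctedTrapezoidal f g t T 4 n
    = trapezoidal f t T n - (Real.pi : ℂ) ^ 4 / 45 * g t * ((mesh T n : ℂ)⁻¹) ^ 3
      - (Real.pi : ℂ) ^ 2 / 6 * iteratedDeriv 2 g t * (mesh T n : ℂ)⁻¹
      + 1 / 24 * iteratedDeriv 4 g t * mesh T n := by
  have h₁ : (2 : ℂ) * 2 = 4 := by norm_num
  have h₂ : (4 : ℂ) - 2 = 2 := by norm_num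
  rw [correctedTrapezoidal]
  simp [Finset.sum_range_succ, h₁, h₂, riemannZeta_zero, riemannZeta_two, riemannZeta_four,
    Nat.factorial]
  ring

theorem SpectrallyAccurate.midpoint {Q : ℕ → ℂ} (h : SpectrallyAccurate Q I) :
    SpectrallyAccurate (fun n => 2 * Q (2 * n) - Q n) I :=
  (((h.comp_mul one_le_two).const_mul 2).add (h.const_mul (-1))).congr
    (fun n _ => by ring) (by ring)

theorem SpectrallyAccurate.extrapolated {Q : ℕ → ℂ} (h : SpectrallyAccurate Q I) :
    SpectrallyAccurate (fun n => 2 * Q n - Q (2 * n)) I :=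
  ((h.const_mul 2).add ((h.comp_mul one_le_two).const_mul (-1))).congr
    (fun n _ => by ring) (by ring)

theorem spectrallyAccurate_rules_one
    (h : SpectrallyAccurate (correctedTrapezoidal f g t T 1) I) :
    SpectrallyAccurate (fun n => trapezoidal f t T n + deriv g t * mesh T n) I ∧
      SpectrallyAccurate (fun n => midpointSum f t T n) I := by
  refine ⟨h.congr (fun n _ => correctedTrapezoidal_one n) rfl,
    h.midpoint.congr (fun n hn => ?_) rfl⟩
  rw [midpointSum_eq f t T hn, correctedTrapezoidal_one, correctedTrapezoidal_one, mesh_mul]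
  push_cast
  ring

theorem spectrallyAccurate_rules_two
    (h : SpectrallyAccurate (correctedTrapezoidal f g t T 2) I) :
    SpectrallyAccurate (fun n => trapezoidal f t T n
        - (Real.pi : ℂ) ^ 2 / 3 * g t * (mesh T n : ℂ)⁻¹
        + 1 / 2 * iteratedDeriv 2 g t * mesh T n) I ∧
      SpectrallyAccurate (fun n => midpointSum f t T n
        - (Real.pi : ℂ) ^ 2 * g t * (mesh T n : ℂ)⁻¹) I ∧
      SpectrallyAccurate (fun n => 2 * midpointSum f t T n - midpointSum f t T (2 * n)) I := by
  have hM : SpectrallyAccurate (fun n => midpointSum f t T n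
      - (Real.pi : ℂ) ^ 2 * g t * (mesh T n : ℂ)⁻¹) I := by
    refine h.midpoint.congr (fun n hn => ?_) rfl
    rw [midpointSum_eq f t T hn, correctedTrapezoidal_two, correctedTrapezoidal_two, mesh_mul]
    push_cast
    rw [inv_div]
    ring
  refine ⟨h.congr (fun n _ => correctedTrapezoidal_two n) rfl, hM,
    hM.extrapolated.congr (fun n _ => ?_) rfl⟩
  rw [mesh_mul]
  push_cast
  rw [inv_div]
  ring

theorem spectrallyAccurate_rules_three
    (h : SpectrallyAccurate (correctedTrapezoidal f g t T 3) I) :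
    SpectrallyAccurate (fun n => trapezoidal f t T n
        - (Real.pi : ℂ) ^ 2 / 3 * deriv g t * (mesh T n : ℂ)⁻¹
        + 1 / 6 * iteratedDeriv 3 g t * mesh T n) I ∧
      SpectrallyAccurate (fun n => midpointSum f t T n
        - (Real.pi : ℂ) ^ 2 * deriv g t * (mesh T n : ℂ)⁻¹) I ∧
      SpectrallyAccurate (fun n => 2 * midpointSum f t T n - midpointSum f t T (2 * n)) I := by
  have hM : SpectrallyAccurate (fun n => midpointSum f t T n
      - (Real.pi : ℂ) ^ 2 * deriv g t * (mesh T n : ℂ)⁻¹) I := by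
    refine h.midpoint.congr (fun n hn => ?_) rfl
    rw [midpointSum_eq f t T hn, correctedTrapezoidal_three, correctedTrapezoidal_three, mesh_mul]
    push_cast
    rw [inv_div]
    ring
  refine ⟨h.congr (fun n _ => correctedTrapezoidal_three n) rfl, hM,
    hM.extrapolated.congr (fun n _ => ?_) rfl⟩
  rw [mesh_mul]
  push_cast
  rw [inv_div]
  ring

theorem spectrallyAccurate_rules_four
    (h : SpectrallyAccurate (correctedTrapezoidal f g t T 4) I) :
    SpectrallyAccurate (fun n => trapezoidal f t T n
        - (Real.pi : ℂ) ^ 4 / 45 * g t * ((mesh T n : ℂ)⁻¹) ^ 3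
        - (Real.pi : ℂ) ^ 2 / 6 * iteratedDeriv 2 g t * (mesh T n : ℂ)⁻¹
        + 1 / 24 * iteratedDeriv 4 g t * mesh T n) I ∧
      SpectrallyAccurate (fun n => midpointSum f t T n
        - (Real.pi : ℂ) ^ 4 / 3 * g t * ((mesh T n : ℂ)⁻¹) ^ 3
        - (Real.pi : ℂ) ^ 2 / 2 * iteratedDeriv 2 g t * (mesh T n : ℂ)⁻¹) I ∧
      SpectrallyAccurate (fun n => 2 * midpointSum f t T n - midpointSum f t T (2 * n)
        + 2 * (Real.pi : ℂ) ^ 4 * g t * ((mesh T n : ℂ)⁻¹) ^ 3) I ∧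
      SpectrallyAccurate (fun n => 16 / 7 * midpointSum f t T n
        - 10 / 7 * midpointSum f t T (2 * n) + 1 / 7 * midpointSum f t T (4 * n)) I := by
  have hM : SpectrallyAccurate (fun n => midpointSum f t T n
      - (Real.pi : ℂ) ^ 4 / 3 * g t * ((mesh T n : ℂ)⁻¹) ^ 3
      - (Real.pi : ℂ) ^ 2 / 2 * iteratedDeriv 2 g t * (mesh T n : ℂ)⁻¹) I := by
    refine h.midpoint.congr (fun n hn => ?_) rfl
    rw [midpointSum_eq f t T hn, correctedTrapezoidal_four, correctedTrapezoidal_four, mesh_mul]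
    push_cast
    rw [inv_div]
    ring
  refine ⟨h.congr (fun n _ => correctedTrapezoidal_four n) rfl, hM,
    hM.extrapolated.congr (fun n _ => ?_) rfl,
    (((hM.const_mul (16 / 7)).add ((hM.comp_mul one_le_two).const_mul (-10 / 7))).add
      ((hM.comp_mul (c := 4) (by norm_num)).const_mul (1 / 7))).congr (fun n _ => ?_) (by ring)⟩
  · rw [mesh_mul]
    push_cast
    rw [inv_div]
    ring
  · rw [mesh_mul, mesh_mul]
    push_cast
    rw [inv_div, inv_div]
    ring

end ExplicitRules

/-! ### The corrected trapezoidal rule as a trapezoidal rule for a smooth function -/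

/-- Folding a sum over the nodes of one period about the singularity. -/
theorem sum_eq_sum_even_part {F : ℝ → ℂ} {T : ℝ} (hT : 0 < T)
    (hper : ∀ u : ℝ, (∀ l : ℤ, u / T ≠ l) → F (u + T) = F u)
    (hneg : ∀ u : ℝ, (∀ l : ℤ, u / T ≠ l) → ∀ l : ℤ, -u / T ≠ l) {n : ℕ} (hn : 1 ≤ n) :
    ∑ j ∈ Finset.Ico 1 n, F (j * mesh T n)
      = ∑ j ∈ Finset.Ico 1 n, (F (j * mesh T n) + F (-(j * mesh T n))) / 2 := by
  have h : ∑ j ∈ Finset.Ico 1 n, F (-(j * mesh T n)) = ∑ j ∈ Finset.Ico 1 n, F (j * mesh T n) := by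
    refine Finset.sum_nbij' (fun j => n - j) (fun j => n - j) ?_ ?_ ?_ ?_ ?_
    · intro j hj; rw [Finset.mem_Ico] at hj ⊢; omega
    · intro j hj; rw [Finset.mem_Ico] at hj ⊢; omega
    · intro j hj; rw [Finset.mem_Ico] at hj; omega
    · intro j hj; rw [Finset.mem_Ico] at hj; omega
    · intro j hj
      have h1 := hneg _ (div_ne_intCast_of_mem_Ioo hT (mul_mesh_mem_Ioo hT hj))
      rw [← hper _ h1, Nat.cast_sub (Finset.mem_Ico.1 hj).2.le, sub_mul, natCast_mul_mesh T hn]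
      congr 1
      ring
  rw [← Finset.sum_div, Finset.sum_add_distrib, h]
  ring

/-- Folding an integral over one period about the singularity. -/
theorem integral_eq_integral_even_part {F : ℝ → ℂ} {T ε : ℝ} (hT : 0 < T)
    (hper : ∀ u : ℝ, (∀ l : ℤ, u / T ≠ l) → F (u + T) = F u)
    (hneg : ∀ u : ℝ, (∀ l : ℤ, u / T ≠ l) → ∀ l : ℤ, -u / T ≠ l)
    (hF : ContinuousOn F (Set.Ioo 0 T)) (hε : ε ∈ Set.Ioo 0 T) :
    ∫ u in ε..(T - ε), F u = ∫ u in ε..(T - ε), (F u + F (-u)) / 2 := by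
  have hε' : T - ε ∈ Set.Ioo 0 T := ⟨by linarith [hε.2], by linarith [hε.1]⟩
  have hmem := Set.ordConnected_Ioo.uIcc_subset hε hε'
  have hi := hF.intervalIntegrable_of_mem_Ioo hε hε'
  have hrefl : ∀ u ∈ Set.uIcc ε (T - ε), F (T - u) = F (-u) := fun u hu => by
    rw [← hper _ (hneg _ (div_ne_intCast_of_mem_Ioo hT (hmem hu)))]
    congr 1
    ring
  have h1 := intervalIntegral.integral_comp_sub_left (a := ε) (b := T - ε) F T
  rw [sub_sub_cancel, intervalIntegral.integral_congr hrefl] at h1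
  have hi' : IntervalIntegrable (fun u => F (-u)) volume ε (T - ε) := by
    have hc : ContinuousOn (fun u => F (T - u)) (Set.Ioo 0 T) :=
      hF.comp (by fun_prop) fun u hu => ⟨by linarith [hu.2], by linarith [hu.1]⟩
    refine (hc.intervalIntegrable_of_mem_Ioo hε hε').congr fun u hu => ?_
    exact hrefl u (Set.uIoc_subset_uIcc hu)
  rw [intervalIntegral.integral_div, intervalIntegral.integral_add hi hi', h1]
  ring

theorem HasHadamardFinitePart.unique {f : ℝ → ℂ} {a t b : ℝ} {I J : ℂ}
    (hI : HasHadamardFinitePart f a t b I) (hJ : HasHadamardFinitePart f a t b J) : J = I := by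
  obtain ⟨-, L, R, hL, hR, rfl⟩ := hI
  obtain ⟨-, L', R', hL', hR', rfl⟩ := hJ
  rw [hL'.unique hL, hR'.unique hR]

/-- The corrected trapezoidal rule is exactly the trapezoidal rule for a smooth periodic function
whose integral is the Hadamard finite part. -/
theorem exists_periodic_regularization {a b t T : ℝ} (hat : a < t) (htb : t < b) (hT : T = b - a)
    (m : ℕ) {f g : ℝ → ℂ} (hg : ContDiffOn ℝ ∞ g (Set.Icc a b))
    (hfg : ∀ x ∈ Set.Icc a b, x ≠ t → f x = g x / ((x - t : ℝ) : ℂ) ^ m)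
    (hper : ∀ x ∈ puncturedLine t T, f (x + T) = f x)
    (hf : ContDiffOn ℝ ∞ f (puncturedLine t T)) :
    ∃ G : ℝ → ℂ, ContDiff ℝ ∞ G ∧ Function.Periodic G T ∧
      HasHadamardFinitePart f a t b (∫ u in (0 : ℝ)..T, G u) ∧
      ∀ n : ℕ, 1 ≤ n → correctedTrapezoidal f g t T m n
        = (mesh T n : ℂ) * ∑ j ∈ Finset.range n, G (j * mesh T n) := by
  have hT0 : 0 < T := by linarith
  obtain ⟨δ, hδ, hδa, hδb, q, hq, hq0, hqe⟩ :=
    exists_contDiff_taylor_quotient_on_Icc hat htb hg m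
  set γ : ℕ → ℂ := fun j => iteratedDeriv j g t / (j.factorial : ℂ) with hγ
  set F : ℝ → ℂ := fun u => f (t + u) with hF
  have hneg : ∀ u : ℝ, (∀ l : ℤ, u / T ≠ l) → ∀ l : ℤ, -u / T ≠ l := by
    intro u hu l hl
    refine hu (-l) ?_
    rw [Int.cast_neg, ← hl]
    ring
  have hFper : ∀ u : ℝ, (∀ l : ℤ, u / T ≠ l) → F (u + T) = F u := by
    intro u hu
    simp only [hF]
    rw [← add_assoc]
    exact hper _ ((mem_puncturedLine_iff hT0 u).2 hu)
  have hFsm : ∀ u : ℝ, (∀ l : ℤ, u / T ≠ l) → ContDiffAt ℝ ∞ F u := by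
    intro u hu
    exact (hf.contDiffAt ((isOpen_puncturedLine hT0).mem_nhds
      ((mem_puncturedLine_iff hT0 u).2 hu))).comp u (contDiffAt_const.add contDiffAt_id)
  have hFpole : ∀ u : ℝ, u ≠ 0 → |u| ≤ δ →
      F u = ∑ j ∈ Finset.range m, γ j * ((u : ℂ) ^ (m - j))⁻¹ + q u := by
    intro u hu0 hu
    have huc : (u : ℂ) ≠ 0 := by exact_mod_cast hu0
    have hu' := abs_le.1 hu
    simp only [hF]
    rw [hfg _ ⟨by linarith [hu'.1], by linarith [hu'.2]⟩ (by simpa using hu0), hqe u hu,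
      add_sub_cancel_left, add_div, mul_div_cancel_left₀ _ (pow_ne_zero _ huc), Finset.sum_div]
    congr 1
    refine Finset.sum_congr rfl fun j hj => ?_
    rw [pow_sub₀ _ huc (Finset.mem_range.1 hj).le]
    simp only [hγ]
    field_simp
  have hFcont : ContinuousOn F (Set.Ioo 0 T) := fun u hu =>
    (hFsm u (div_ne_intCast_of_mem_Ioo hT0 hu)).continuousAt.continuousWithinAt
  have hfcont : ContinuousOn f (Set.Icc a b \ {t}) := by
    refine hf.continuousOn.mono fun x hx => ?_
    obtain ⟨⟨h1, h2⟩, h3⟩ := hx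
    rw [← add_sub_cancel t x, mem_puncturedLine_iff hT0]
    rcases lt_or_gt_of_ne h3 with h | h
    · have h4 := hneg _ (div_ne_intCast_of_mem_Ioo hT0
        (show t - x ∈ Set.Ioo 0 T from ⟨by linarith, by linarith⟩))
      rwa [neg_sub] at h4
    · exact div_ne_intCast_of_mem_Ioo hT0 ⟨by linarith, by linarith⟩
  have hfintL : ∀ {x y : ℝ}, x ∈ Set.Ico a t → y ∈ Set.Ico a t →
      IntervalIntegrable f volume x y := fun hx hy =>
    (hfcont.mono fun z hz => by
      have h := Set.ordConnected_Ico.uIcc_subset hx hy hz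
      exact ⟨⟨h.1, h.2.le.trans htb.le⟩, h.2.ne⟩).intervalIntegrable
  have hfintR : ∀ {x y : ℝ}, x ∈ Set.Ioc t b → y ∈ Set.Ioc t b →
      IntervalIntegrable f volume x y := fun hx hy =>
    (hfcont.mono fun z hz => by
      have h := Set.ordConnected_Ioc.uIcc_subset hx hy hz
      exact ⟨⟨hat.le.trans h.1.le, h.2⟩, h.1.ne'⟩).intervalIntegrable
  have hkpos : ∀ j ∈ Finset.range m, 1 ≤ m - j := fun j hj => by
    have := Finset.mem_range.1 hj
    omega
  -- the two one-sided finite parts exist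
  obtain ⟨R, hR⟩ : ∃ R, HasFinitePartAtZero (fun ε => ∫ x in (t + ε)..b, f x) R := by
    obtain ⟨R, hR⟩ := exists_hasFinitePartAtZero_integral (H := F) hδ hkpos hq.continuous
      fun x hx => hFpole x hx.1.ne' (by rw [abs_of_pos hx.1]; exact hx.2)
    refine ⟨_, (hR.add (hasFinitePartAtZero_of_tendsto
      (tendsto_const_nhds (x := ∫ x in (t + δ)..b, f x)))).congr' ?_⟩
    filter_upwards [Ioo_mem_nhdsGT hδ] with ε hε
    rw [intervalIntegral.integral_comp_add_left f t,
      intervalIntegral.integral_add_adjacent_intervals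
        (hfintR ⟨by linarith [hε.1], by linarith [hε.2]⟩ ⟨by linarith, by linarith⟩)
        (hfintR ⟨by linarith, by linarith⟩ ⟨htb, le_rfl⟩)]
  obtain ⟨L, hL⟩ : ∃ L, HasFinitePartAtZero (fun ε => ∫ x in a..(t - ε), f x) L := by
    obtain ⟨L, hL⟩ := exists_hasFinitePartAtZero_integral (H := fun u => f (t - u))
      (q := fun u => q (-u)) (c := fun j => γ j * (-1) ^ (m - j)) hδ hkpos
      (hq.continuous.comp continuous_neg) fun x hx => by
        have h1 := hFpole (-x) (neg_ne_zero.2 hx.1.ne')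
          (by rw [abs_neg, abs_of_pos hx.1]; exact hx.2)
        simp only [hF, ← sub_eq_add_neg] at h1
        rw [h1]
        congr 1
        refine Finset.sum_congr rfl fun j _ => ?_
        rw [Complex.ofReal_neg, neg_pow, mul_inv, ← inv_pow (-1 : ℂ), inv_neg_one, mul_assoc]
    refine ⟨_, ((hasFinitePartAtZero_of_tendsto
      (tendsto_const_nhds (x := ∫ x in a..(t - δ), f x))).add hL).congr' ?_⟩
    filter_upwards [Ioo_mem_nhdsGT hδ] with ε hε
    rw [intervalIntegral.integral_comp_sub_left f t,
      intervalIntegral.integral_add_adjacent_intervals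
        (hfintL ⟨le_rfl, hat⟩ ⟨by linarith, by linarith⟩)
        (hfintL ⟨by linarith, by linarith⟩ ⟨by linarith [hε.2], by linarith [hε.1]⟩)]
  -- by periodicity they add up to the finite part over the period following the singularity
  have hLR : HasFinitePartAtZero (fun ε => ∫ u in ε..(T - ε), (F u + F (-u)) / 2) (L + R) := by
    refine (hL.add hR).congr' ?_
    filter_upwards [Ioo_mem_nhdsGT hδ] with ε hε
    have hε1 : ε ∈ Set.Ioo 0 T := ⟨hε.1, by linarith [hε.2]⟩
    have hε2 : T - ε ∈ Set.Ioo 0 T := ⟨by linarith [hε.2], by linarith [hε.1]⟩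
    have hbt : b - t ∈ Set.Ioo 0 T := ⟨by linarith, by linarith⟩
    rw [← integral_eq_integral_even_part hT0 hFper hneg hFcont hε1,
      ← intervalIntegral.integral_add_adjacent_intervals
        (hFcont.intervalIntegrable_of_mem_Ioo hε1 hbt)
        (hFcont.intervalIntegrable_of_mem_Ioo hbt hε2)]
    simp only [hF]
    rw [intervalIntegral.integral_comp_add_left f t, intervalIntegral.integral_comp_add_left f t,
      add_comm, add_sub_cancel]
    congr 1
    have h1 := intervalIntegral.integral_comp_add_right (a := a) (b := t - ε) f T
    rw [show a + T = b by linarith, show t - ε + T = t + (T - ε) by ring] at h1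
    rw [← h1]
    refine intervalIntegral.integral_congr fun x hx => ?_
    have hx' := Set.ordConnected_Ico.uIcc_subset (show a ∈ Set.Ico a t from ⟨le_rfl, hat⟩)
      (show t - ε ∈ Set.Ico a t from ⟨by linarith [hε.2], by linarith [hε.1]⟩) hx
    have h2 := hneg _ (div_ne_intCast_of_mem_Ioo hT0
      (show t - x ∈ Set.Ioo 0 T from ⟨by linarith [hx'.2], by linarith [hx'.1]⟩))
    rw [neg_sub, ← mem_puncturedLine_iff (t := t) hT0, add_sub_cancel] at h2
    exact (hper x h2).symm
  -- remove the poles of the even part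
  have hk : ∀ i ∈ Finset.range (m / 2), 2 ≤ 2 * (m / 2 - i) := fun i hi => by
    have := Finset.mem_range.1 hi
    omega
  have he : ∀ i ∈ Finset.range (m / 2), Even (2 * (m / 2 - i)) := fun i _ => even_two_mul _
  obtain ⟨G, hG, hGper, hG0, hGH⟩ := exists_contDiff_periodic_sub_latticeSum (T := T) (δ := δ)
    (H := fun u => (F u + F (-u)) / 2) (p := fun u => (q u + q (-u)) / 2)
    (a := fun i => γ (2 * i + m % 2)) hT0 hδ hk he
    ((hq.add (hq.comp contDiff_neg)).div_const 2)
    (fun u hu => by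
      have h1 : ∀ l : ℤ, (-(u + T)) / T ≠ l := fun l hl => by
        refine hneg u hu (l + 1) ?_
        rw [Int.cast_add, ← hl]
        field_simp
        push_cast
        ring
      rw [hFper u hu, ← hFper (-(u + T)) h1]
      ring_nf)
    (fun u hu => ((hFsm u hu).add ((hFsm (-u) (hneg u hu)).comp u contDiffAt_id.neg)).div_const 2)
    (fun u hu0 hu => even_part_polar_expansion (hFpole u hu0 hu.le)
      (hFpole (-u) (neg_ne_zero.2 hu0) (by rw [abs_neg]; exact hu.le)))
  have hI := (hasFinitePartAtZero_integral_of_decomposition hT0 hk he hG.continuous hGH).unique hLR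
  refine ⟨G, hG, hGper, ⟨?_, L, R, hL, hR, hI⟩, fun n hn => ?_⟩
  · filter_upwards [Ioo_mem_nhdsGT hδ] with ε hε
    exact ⟨hfintL ⟨le_rfl, hat⟩ ⟨by linarith [hε.2], by linarith [hε.1]⟩,
      hfintR ⟨by linarith [hε.1], by linarith [hε.2]⟩ ⟨htb, le_rfl⟩⟩
  · have h1 := mesh_mul_sum_eq (p := fun u => (q u + q (-u)) / 2) hT0 hk he hG0 hGH hn
    rw [← sum_eq_sum_even_part hT0 hFper hneg hn] at h1
    rw [correctedTrapezoidal, trapezoidal, h1, Finset.sum_range_succ]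
    have h2 : 2 * (m / 2) + m % 2 = m := Nat.div_add_mod m 2
    -- the last term of the correction, with `ζ 0 = -1 / 2`, accounts for the missing node
    have h3 : iteratedDeriv (2 * (m / 2) + m % 2) g t / ((2 * (m / 2) + m % 2).factorial : ℂ) *
        riemannZeta (2 * ((m / 2 : ℕ) : ℂ) - 2 * ((m / 2 : ℕ) : ℂ)) *
        (mesh T n : ℂ) ^ (2 * ((m / 2 : ℕ) : ℤ) + 1 - 2 * ((m / 2 : ℕ) : ℤ))
        = -(mesh T n * q 0) / 2 := by
      rw [h2, ← hq0, sub_self, riemannZeta_zero, add_sub_cancel_left, zpow_one]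
      ring
    have h4 : ∀ i ∈ Finset.range (m / 2),
        iteratedDeriv (2 * i + m % 2) g t / ((2 * i + m % 2).factorial : ℂ) *
          riemannZeta (2 * ((m / 2 : ℕ) : ℂ) - 2 * (i : ℂ)) *
          (mesh T n : ℂ) ^ (2 * (i : ℤ) + 1 - 2 * ((m / 2 : ℕ) : ℤ))
        = γ (2 * i + m % 2) * (2 * riemannZeta ((2 * (m / 2 - i) : ℕ) : ℂ)) *
          (mesh T n : ℂ) ^ (1 - ((2 * (m / 2 - i) : ℕ) : ℤ)) / 2 := by
      intro i hi
      have hi' := (Finset.mem_range.1 hi).le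
      have e1 : ((2 * (m / 2 - i) : ℕ) : ℂ) = 2 * ((m / 2 : ℕ) : ℂ) - 2 * (i : ℂ) := by
        rw [Nat.cast_mul, Nat.cast_sub hi']
        push_cast
        ring
      have e2 : 1 - ((2 * (m / 2 - i) : ℕ) : ℤ) = 2 * (i : ℤ) + 1 - 2 * ((m / 2 : ℕ) : ℤ) := by
        rw [Nat.cast_mul, Nat.cast_sub hi']
        push_cast
        ring
      rw [e1, e2]
      ring
    rw [h3, Finset.sum_congr rfl h4, ← Finset.sum_div]
    simp only [neg_zero]
    ring

theorem theorem4p1 (a b t T : ℝ) (hat : a < t) (htb : t < b) (hT : T = b - a)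
    (m : ℕ) (hm : 1 ≤ m) (f g : ℝ → ℂ)
    (hg : ContDiffOn ℝ ∞ g (Set.Icc a b))
    (hfg : ∀ x ∈ Set.Icc a b, x ≠ t → f x = g x / ((x - t : ℝ) : ℂ) ^ m)
    (hper : ∀ x ∈ puncturedLine t T, f (x + T) = f x)
    (hf : ContDiffOn ℝ ∞ f (puncturedLine t T)) :
    ∃ I : ℂ, HasHadamardFinitePart f a t b I ∧
      (∀ J : ℂ, HasHadamardFinitePart f a t b J → J = I) ∧
      -- the rules obtained by `s` Richardson-like steps
      (∀ s : ℕ, SpectrallyAccurate (richardsonRule f g t T m s) I) ∧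
      -- arbitrary combinations with coefficients of sum one
      (∀ (s : ℕ) (α : ℕ → ℂ), ∑ k ∈ Finset.range (s + 1), α k = 1 →
        SpectrallyAccurate (fun n => ∑ k ∈ Finset.range (s + 1),
          α k * correctedTrapezoidal f g t T m (2 ^ k * n)) I) ∧
      -- the explicit rules
      (m = 1 →
        SpectrallyAccurate (fun n => trapezoidal f t T n + deriv g t * mesh T n) I ∧
        SpectrallyAccurate (fun n => midpointSum f t T n) I) ∧
      (m = 2 →
        SpectrallyAccurate (fun n => trapezoidal f t T n
          - (Real.pi : ℂ) ^ 2 / 3 * g t * (mesh T n : ℂ)⁻¹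
          + 1 / 2 * iteratedDeriv 2 g t * mesh T n) I ∧
        SpectrallyAccurate (fun n => midpointSum f t T n
          - (Real.pi : ℂ) ^ 2 * g t * (mesh T n : ℂ)⁻¹) I ∧
        SpectrallyAccurate (fun n => 2 * midpointSum f t T n - midpointSum f t T (2 * n)) I) ∧
      (m = 3 →
        SpectrallyAccurate (fun n => trapezoidal f t T n
          - (Real.pi : ℂ) ^ 2 / 3 * deriv g t * (mesh T n : ℂ)⁻¹
          + 1 / 6 * iteratedDeriv 3 g t * mesh T n) I ∧
        SpectrallyAccurate (fun n => midpointSum f t T n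
          - (Real.pi : ℂ) ^ 2 * deriv g t * (mesh T n : ℂ)⁻¹) I ∧
        SpectrallyAccurate (fun n => 2 * midpointSum f t T n - midpointSum f t T (2 * n)) I) ∧
      (m = 4 →
        SpectrallyAccurate (fun n => trapezoidal f t T n
          - (Real.pi : ℂ) ^ 4 / 45 * g t * ((mesh T n : ℂ)⁻¹) ^ 3
          - (Real.pi : ℂ) ^ 2 / 6 * iteratedDeriv 2 g t * (mesh T n : ℂ)⁻¹
          + 1 / 24 * iteratedDeriv 4 g t * mesh T n) I ∧
        SpectrallyAccurate (fun n => midpointSum f t T n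
          - (Real.pi : ℂ) ^ 4 / 3 * g t * ((mesh T n : ℂ)⁻¹) ^ 3
          - (Real.pi : ℂ) ^ 2 / 2 * iteratedDeriv 2 g t * (mesh T n : ℂ)⁻¹) I ∧
        SpectrallyAccurate (fun n => 2 * midpointSum f t T n - midpointSum f t T (2 * n)
          + 2 * (Real.pi : ℂ) ^ 4 * g t * ((mesh T n : ℂ)⁻¹) ^ 3) I ∧
        SpectrallyAccurate (fun n => 16 / 7 * midpointSum f t T n
          - 10 / 7 * midpointSum f t T (2 * n) + 1 / 7 * midpointSum f t T (4 * n)) I) := by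
  obtain ⟨G, hG, hGper, hI, hQ⟩ := exists_periodic_regularization hat htb hT m hg hfg hper hf
  have hspec : SpectrallyAccurate (correctedTrapezoidal f g t T m) (∫ u in (0 : ℝ)..T, G u) := by
    refine spectrallyAccurate_of_le_mesh_pow (T := T) fun K => ?_
    obtain ⟨C, hC⟩ := exists_norm_trapezoid_sub_integral_le (by linarith) hG hGper K
    exact ⟨C, fun n hn => by rw [hQ n hn]; exact hC n hn⟩
  refine ⟨_, hI, fun J hJ => hI.unique hJ, spectrallyAccurate_richardsonRule hspec,
    fun s α hα => spectrallyAccurate_combination hspec hα, ?_, ?_, ?_, ?_⟩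
  · rintro rfl
    exact spectrallyAccurate_rules_one hspec
  · rintro rfl
    exact spectrallyAccurate_rules_two hspec
  · rintro rfl
    exact spectrallyAccurate_rules_three hspec
  · rintro rfl
    exact spectrallyAccurate_rules_four hspec
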